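/- **Setting.** Let $N_x, m_0, m_1 \ge 1$, $N_2 \ge 2$, $N_1 = (N_2-1)m_1+1$ and $N_0 = (N_1-1)m_0+1$. Let $\Phi_0,\Phi_1,\Phi_2$ be $N_x\times N_x$ matrices that are simultaneously diagonalizable, $\Phi_\ell = U\Lambda_\ell U^{-1}$ with $\Lambda_\ell=\operatorname{diag}(\lambda_{\ell,1},\dots,\lambda_{\ell,N_x})$ (complex eigenvalues) and $|\lambda_{\ell,k}|<1$ for all $\ell,k$. Let $A_\ell$ be the block matrix on $N_\ell$ time points with identity diagonal blocks and $-\Phi_\ell$ on the first block subdiagonal. The C-points of level $\ell\in\{0,1\}$ are the time points whose index is a multiple of $m_\ell$; the others are F-points. Let $P_\ell$ be ideal interpolation (block column $q$ has the blocks $I,\Phi_\ell,\dots,\Phi_\ell^{m_\ell-1}$ in block rows $qm_\ell,\dots,qm_\ell+m_\ell-1$, truncated to $I$ in the last column), $R_\ell$ ideal restriction (block row $q$ has the blocks $\Phi_\ell^{m_\ell-1},\dots,\Phi_\ell,I$ in block columns $qm_\ell-m_\ell+1,\dots,qm_\ell$, truncated to $I$ for $q=0$), $R_{I_0}$ injection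 at the C-points of level $0$, and $S_\ell$ the embedding of the F-point unknowns of level $\ell$. One three-level MGRIT V-cycle with F-relaxation for $A_0u=g$ consists of: F-relaxation $u\leftarrow u+S_0(S_0^TA_0S_0)^{-1}S_0^T(g-A_0u)$; restriction $g_1=R_0(g-A_0u)$; on level 1, starting from $v=0$, F-relaxation for $A_1v=g_1$ followed by $v\leftarrow v+P_1A_2^{-1}R_1(g_1-A_1v)$; and the correction $u\leftarrow u+P_0v$. Let $u_0,u_1,\dots$ be the iterates, $r_i=g-A_0u_i$, and let $c_f=\sup_{i\ge0}\|r_{i+1}\|/\|r_i\|$ (with $0/0=0$), the norm being $\|r\|=\sqrt{r^*(\tilde U\tilde U^*)^{-1}r}$ with $\tilde U$ block diagonal with diagonal blocks $U$. Finally let $$\mathcal E=P_0R_{I_0}-P_0P_1A_2^{-1}R_1R_0A_0P_0R_{I_0}-P_0S_1(S_1^TA_1S_1)^{-1}S_1^TR_0A_0P_0R_{I_0}$$ be the error propagator of the V-cycle, and $\mathcal E_F^{3,\Delta}=R_{I_0}\mathcal E P_0$ the error propagator on level 1, formed for the diagonalized operators (with $\Lambda_\ell$ in place of $\Phi_\ell$).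 **Theorem.** For every right-hand side $g$ and every initial guess $u_0$ whose residual vanishes at the F-points of level $0$ (as it does after F-relaxation), or which is itself the result of a V-cycle (so that all iterations except possibly the first are covered for an arbitrary initial guess), $$c_f\le\sqrt{\|\mathcal E_F^{3,\Delta}\|_1\,\|\mathcal E_F^{3,\Delta}\|_\infty}.$$ If $U$ is unitary, the same bound holds with the $\ell^2$-norm in the definition of $c_f$. Moreover, writing $g_n(z)=\frac{1-|z|^n}{1-|z|}$, $a_k=|\lambda_{1,k}-\lambda_{0,k}^{m_0}|$ and $b_k=|\lambda_{2,k}-\lambda_{0,k}^{m_0}\lambda_{1,k}^{m_1-1}|$, $$\|\mathcal E_F^{3,\Delta}\|_1=\max_{1\le k\le N_x}\ \max_{0\le j\le m_1-1}c_j(k),\qquad \|\mathcal E_F^{3,\Delta}\|_\infty=\max_{1\le k\le N_x}\ \max_{0\le j\le m_1-1}\rho_j(k),$$ where the absolute column sums of the first CF-interval on level 1 are $$c_0(k)=b_k\left(|\lambda_{2,k}|^{N_2-2}+g_{N_2-2}(\lambda_{2,k})\,g_{m_1}(\lambda_{1,k})\right)+a_k\,g_{m_1-1}(\lambda_{1,k}),$$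 $$c_j(k)=|\lambda_{1,k}|^{j-1}a_k\left(|\lambda_{2,k}|^{N_2-2}+g_{N_2-2}(\lambda_{2,k})\,g_{m_1}(\lambda_{1,k})\right)+a_k\,g_{j-1}(\lambda_{1,k}),\quad 1\le j\le m_1-1,$$ and the absolute row sums of the last FC-interval on level 1 are $$\rho_0(k)=b_k\,g_{N_2-1}(\lambda_{2,k})+a_k\,g_{N_2-1}(\lambda_{2,k})\,g_{m_1-1}(\lambda_{1,k}),$$ $$\rho_j(k)=a_k\,g_j(\lambda_{1,k})+|\lambda_{1,k}|^j g_{N_2-2}(\lambda_{2,k})\,b_k+|\lambda_{1,k}|^j g_{N_2-2}(\lambda_{2,k})\,a_k\,g_{m_1-1}(\lambda_{1,k}),\quad 1\le j\le m_1-1.$$ -/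

import Mathlib

open scoped Matrix Kronecker

noncomputable section

namespace MGRIT

/-- Space-time vectors with `N` time points and `Nx` spatial unknowns. -/
abbrev Vec (N Nx : ℕ) : Type := Fin N × Fin Nx → ℂ

/-- Space-time operators, from `M` time points to `N` time points. -/
abbrev Op (N M Nx : ℕ) : Type := Matrix (Fin N × Fin Nx) (Fin M × Fin Nx) ℂ

/-- The operator whose block in block row `i` and block column `j` is `B i j`. -/
def block {N M Nx : ℕ} (B : Fin N → Fin M → Matrix (Fin Nx) (Fin Nx) ℂ) : Op N M Nx :=
  Matrix.of fun p q => B p.1 q.1 p.2 q.2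

/-- The space-time matrix `A` of the one-step method `Φ` on `N` time points: identity blocks on the
diagonal, `-Φ` on the first subdiagonal. -/
def timeMat (N : ℕ) {Nx : ℕ} (Φ : Matrix (Fin Nx) (Fin Nx) ℂ) : Op N N Nx :=
  block fun i j => if i = j then 1 else if (i : ℕ) = j + 1 then -Φ else 0

/-- Ideal restriction from `N` fine to `M` coarse time points, coarsening factor `m`: block row `q`
carries `Φ ^ (m - 1), …, Φ, I` at the fine points `q * m - (m - 1), …, q * m` (only the block `I` at
the fine point `0` when `q = 0`). -/
def idealRestrict (m N M : ℕ) {Nx : ℕ} (Φ : Matrix (Fin Nx) (Fin Nx) ℂ) : Op M N Nx :=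
  block fun q i => if (i : ℕ) ≤ q * m ∧ (q : ℕ) * m < i + m then Φ ^ ((q : ℕ) * m - i) else 0

/-- Ideal interpolation from `M` coarse to `N` fine time points, coarsening factor `m`: block column
`q` carries `I, Φ, …, Φ ^ (m - 1)` at the fine points `q * m, …, q * m + m - 1` (only `I` for the last
coarse point, which is the last fine point). -/
def idealInterp (m N M : ℕ) {Nx : ℕ} (Φ : Matrix (Fin Nx) (Fin Nx) ℂ) : Op N M Nx :=
  block fun i q => if (q : ℕ) * m ≤ i ∧ (i : ℕ) < q * m + m then Φ ^ ((i : ℕ) - q * m) else 0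

/-- Restriction by injection: the value at the C-point `q * m`. -/
def injRestrict (m N M Nx : ℕ) : Op M N Nx :=
  block fun q i => if (i : ℕ) = q * m then 1 else 0

/-- The F-points: the time points whose index is not a multiple of the coarsening factor. -/
abbrev FPoint (m N : ℕ) : Type := {i : Fin N // ¬ m ∣ (i : ℕ)}

/-- The operator `S` that embeds the F-point unknowns into all unknowns. -/
def fEmbed (m N Nx : ℕ) : Matrix (Fin N × Fin Nx) (FPoint m N × Fin Nx) ℂ :=
  Matrix.of fun p q => if p.1 = q.1.1 ∧ p.2 = q.2 then 1 else 0

/-- `S (Sᵀ A S)⁻¹ Sᵀ`: the exact solve on the F-points. -/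
def fSolve (m N : ℕ) {Nx : ℕ} (Φ : Matrix (Fin Nx) (Fin Nx) ℂ) : Op N N Nx :=
  fEmbed m N Nx * ((fEmbed m N Nx)ᵀ * timeMat N Φ * fEmbed m N Nx)⁻¹ * (fEmbed m N Nx)ᵀ

/-- The residual `g - A u`. -/
def residual {N Nx : ℕ} (Φ : Matrix (Fin Nx) (Fin Nx) ℂ) (g u : Vec N Nx) : Vec N Nx :=
  g - timeMat N Φ *ᵥ u

/-- F-relaxation for `A u = g`: all F-points are updated so that their residual vanishes. -/
def fRelax (m : ℕ) {N Nx : ℕ} (Φ : Matrix (Fin Nx) (Fin Nx) ℂ) (g u : Vec N Nx) : Vec N Nx :=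
  u + fSolve m N Φ *ᵥ residual Φ g u

/-- The approximate solve on level 1: starting from zero, F-relaxation followed by a correction that
is restricted to level 2, solved there exactly and interpolated back. -/
def levelOneCycle (m₁ N₁ N₂ : ℕ) {Nx : ℕ} (Φ : Fin 3 → Matrix (Fin Nx) (Fin Nx) ℂ)
    (g : Vec N₁ Nx) : Vec N₁ Nx :=
  let v := fRelax m₁ (Φ 1) g 0
  v + idealInterp m₁ N₁ N₂ (Φ 1) *ᵥ
    ((timeMat N₂ (Φ 2))⁻¹ *ᵥ (idealRestrict m₁ N₁ N₂ (Φ 1) *ᵥ residual (Φ 1) g v))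

/-- One three-level MGRIT V-cycle with F-relaxation for the fine-grid system `A₀ u = g`, applied to
the current iterate `u`. -/
def vCycle (m₀ m₁ N₀ N₁ N₂ : ℕ) {Nx : ℕ} (Φ : Fin 3 → Matrix (Fin Nx) (Fin Nx) ℂ)
    (g u : Vec N₀ Nx) : Vec N₀ Nx :=
  let v := fRelax m₀ (Φ 0) g u
  v + idealInterp m₀ N₀ N₁ (Φ 0) *ᵥ
    levelOneCycle m₁ N₁ N₂ Φ (idealRestrict m₀ N₀ N₁ (Φ 0) *ᵥ residual (Φ 0) g v)

/-- The convergence factor `sup_i ‖r_{i+1}‖ / ‖r_i‖` of the fine-grid residual of the V-cycle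
iteration with initial guess `u`, measured with `nrm`. In `ℝ≥0∞`, `0 / 0 = 0` (the iteration has
already converged) and `x / 0 = ∞` for `x > 0`. -/
def convFactor (m₀ m₁ N₀ N₁ N₂ : ℕ) {Nx : ℕ} (Φ : Fin 3 → Matrix (Fin Nx) (Fin Nx) ℂ)
    (nrm : Vec N₀ Nx → ℝ) (g u : Vec N₀ Nx) : ENNReal :=
  ⨆ i : ℕ, ENNReal.ofReal (nrm (residual (Φ 0) g ((vCycle m₀ m₁ N₀ N₁ N₂ Φ g)^[i + 1] u))) /
    ENNReal.ofReal (nrm (residual (Φ 0) g ((vCycle m₀ m₁ N₀ N₁ N₂ Φ g)^[i] u)))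

/-- The `ℓ²`-norm of a space-time vector. -/
def l2Norm {N Nx : ℕ} (r : Vec N Nx) : ℝ := ‖WithLp.toLp 2 r‖

/-- The `(Ũ Ũ*)⁻¹`-norm `√(r* (Ũ Ũ*)⁻¹ r)`, where `Ũ` is block diagonal with diagonal blocks `U`. -/
def modNorm {N Nx : ℕ} (U : Matrix (Fin Nx) (Fin Nx) ℂ) (r : Vec N Nx) : ℝ :=
  let V : Op N N Nx := (1 : Matrix (Fin N) (Fin N) ℂ) ⊗ₖ U
  √(star r ⬝ᵥ ((V * Vᴴ)⁻¹ *ᵥ r)).re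

/-- The error propagator of the three-level V-cycle with F-relaxation on level 0,
`P₀ R_{I₀} - P₀ P₁ A₂⁻¹ R₁ R₀ A₀ P₀ R_{I₀} - P₀ S₁ (S₁ᵀ A₁ S₁)⁻¹ S₁ᵀ R₀ A₀ P₀ R_{I₀}`. -/
def errProp (m₀ m₁ N₀ N₁ N₂ : ℕ) {Nx : ℕ} (Φ : Fin 3 → Matrix (Fin Nx) (Fin Nx) ℂ) :
    Op N₀ N₀ Nx :=
  let P₀ := idealInterp m₀ N₀ N₁ (Φ 0)
  let P₁ := idealInterp m₁ N₁ N₂ (Φ 1)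
  let R₀ := idealRestrict m₀ N₀ N₁ (Φ 0)
  let R₁ := idealRestrict m₁ N₁ N₂ (Φ 1)
  let RI₀ := injRestrict m₀ N₀ N₁ Nx
  P₀ * RI₀
    - (P₀ * P₁) * (timeMat N₂ (Φ 2))⁻¹ * (R₁ * R₀) * timeMat N₀ (Φ 0) * P₀ * RI₀
    - P₀ * fSolve m₁ N₁ (Φ 1) * R₀ * timeMat N₀ (Φ 0) * P₀ * RI₀

/-- The error propagator on level 1, `R_{I₀} E P₀`. -/
def errPropCoarse (m₀ m₁ N₀ N₁ N₂ : ℕ) {Nx : ℕ} (Φ : Fin 3 → Matrix (Fin Nx) (Fin Nx) ℂ) :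
    Op N₁ N₁ Nx :=
  injRestrict m₀ N₀ N₁ Nx * errProp m₀ m₁ N₀ N₁ N₂ Φ * idealInterp m₀ N₀ N₁ (Φ 0)

/-- The matrix norm `‖·‖₁`: maximum absolute column sum. -/
def normOne {ι : Type*} [Fintype ι] (M : Matrix ι ι ℂ) : ℝ := ⨆ j, ∑ i, ‖M i j‖

/-- The matrix norm `‖·‖_∞`: maximum absolute row sum. -/
def normInf {ι : Type*} [Fintype ι] (M : Matrix ι ι ℂ) : ℝ := ⨆ i, ∑ j, ‖M i j‖

/-- `(1 - |z| ^ n) / (1 - |z|)`. -/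
def geo (z : ℂ) (n : ℕ) : ℝ := (1 - ‖z‖ ^ n) / (1 - ‖z‖)

/-- Absolute column sums of the first CF-interval on level 1 for one mode with eigenvalues
`x, y, z` of `Φ 0, Φ 1, Φ 2`: `j = 0` is the C-point, and `j = 1, …, m₁ - 1` is the F-point
number `m₁ - j`. -/
def colSum (m₀ m₁ N₂ : ℕ) (x y z : ℂ) (j : ℕ) : ℝ :=
  if j = 0 then
    ‖z - x ^ m₀ * y ^ (m₁ - 1)‖ * (‖z‖ ^ (N₂ - 2) + geo z (N₂ - 2) * geo y m₁)
      + ‖y - x ^ m₀‖ * geo y (m₁ - 1)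
  else
    ‖y‖ ^ (j - 1) * ‖y - x ^ m₀‖ * (‖z‖ ^ (N₂ - 2) + geo z (N₂ - 2) * geo y m₁)
      + ‖y - x ^ m₀‖ * geo y (j - 1)

/-- Absolute row sums of the last FC-interval on level 1 for one mode with eigenvalues `x, y, z` of
`Φ 0, Φ 1, Φ 2`: `j = 0` is the last C-point, and `j = 1, …, m₁ - 1` is the `j`-th F-point of the
interval. -/
def rowSum (m₀ m₁ N₂ : ℕ) (x y z : ℂ) (j : ℕ) : ℝ :=
  if j = 0 then
    ‖z - x ^ m₀ * y ^ (m₁ - 1)‖ * geo z (N₂ - 1)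
      + ‖y - x ^ m₀‖ * geo z (N₂ - 1) * geo y (m₁ - 1)
  else
    ‖y - x ^ m₀‖ * geo y j
      + ‖y‖ ^ j * geo z (N₂ - 2) * ‖z - x ^ m₀ * y ^ (m₁ - 1)‖
      + ‖y‖ ^ j * geo z (N₂ - 2) * ‖y - x ^ m₀‖ * geo y (m₁ - 1)

end MGRIT

end

/-! Ideal interpolation solves the time stepping inside each interval, so `A₀ P₀ = R_{I₀}ᵀ A_Δ`,
where `A_Δ` is the time-stepping matrix with step `Φ₀ ^ m₀` on level 1 (`stepMat_mul_interpMat`).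
Dually `R₀ R_{I₀}ᵀ = I`. The level-1 cycle is a linear map `C = P₁ A₂⁻¹ R₁ + S₁ (S₁ᵀ A₁ S₁)⁻¹ S₁ᵀ`;
the two summands simply add because `R₁ A₁` annihilates the F-solve
(`restrictMat_mul_stepMat_mul_fSolveMat`, `levelOneCycle_eq`). Hence the level-1 error propagator is
`I - C A_Δ` (`errPropCoarse_eq`). A residual that lives on the C-points, with values `σ`, is sent by
a V-cycle to one with values `(I - A_Δ C) σ` (`residual_vCycle`).

The bound compares these two products. For scalar steps, reversing time and transposing fixes `A_Δ`
and `C`, and therefore turns `I - A_Δ C` into `I - C A_Δ` (`resMat_eq_errMat_rev`). Row sums of one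
are column sums of the other, and the Schur test `l2Norm_mulVec_le` bounds the ℓ² operator norm of
the residual propagator by the square root of the product of the two norms of the error propagator.
Conjugation by `Ũ` reduces general `Φ` to the diagonal case, since the modified norm of `r` is the
ℓ²-norm of `Ũ⁻¹ r` (`modNorm_eq`).

The norms themselves follow from the explicit entries of `I - C A_Δ` (`errMat_apply`). Geometric
sums give each absolute row and column sum. A column sum grows with the number of later intervals
and a row sum with the number of earlier ones, so the first and the last interval are extremal. -/

namespace MGRIT

/-! ### One-step time-stepping matrices over an arbitrary ring -/

section Ring

variable {R : Type*} [Ring R]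

/-- The time-stepping matrix: ones on the diagonal, `-φ` on the first subdiagonal. -/
def stepMat (N : ℕ) (φ : R) : Matrix (Fin N) (Fin N) R :=
  Matrix.of fun i j => if i = j then 1 else if (i : ℕ) = j + 1 then -φ else 0

/-- The inverse of `stepMat`. -/
def stepInv (N : ℕ) (φ : R) : Matrix (Fin N) (Fin N) R :=
  Matrix.of fun i j => if (j : ℕ) ≤ i then φ ^ ((i : ℕ) - j) else 0

/-- Ideal restriction with entries in a ring. -/
def restrictMat (m N M : ℕ) (φ : R) : Matrix (Fin M) (Fin N) R :=
  Matrix.of fun q i =>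
    if (i : ℕ) ≤ q * m ∧ (q : ℕ) * m < i + m then φ ^ ((q : ℕ) * m - i) else 0

/-- Ideal interpolation with entries in a ring. -/
def interpMat (m N M : ℕ) (φ : R) : Matrix (Fin N) (Fin M) R :=
  Matrix.of fun i q =>
    if (q : ℕ) * m ≤ i ∧ (i : ℕ) < q * m + m then φ ^ ((i : ℕ) - q * m) else 0

/-- Injection at the C-points with entries in a ring. -/
def injMat (R : Type*) [Ring R] (m N M : ℕ) : Matrix (Fin M) (Fin N) R :=
  Matrix.of fun q i => if (i : ℕ) = q * m then 1 else 0

/-- The exact solve on the F-points, in closed form. -/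
def fSolveMat (m N : ℕ) (φ : R) : Matrix (Fin N) (Fin N) R :=
  Matrix.of fun i j =>
    if ¬ m ∣ (j : ℕ) ∧ (j : ℕ) ≤ i ∧ (i : ℕ) / m = j / m then φ ^ ((i : ℕ) - j) else 0

/-- Entries are a function on `ℕ`, not on `Fin N`, so that the previous row is `x (i - 1)` without a
bounds proof; the truncated value at `i = 0` is masked. -/
theorem stepMat_mul_of {N : ℕ} {κ : Type*} (φ : R) (x : ℕ → κ → R) :
    stepMat N φ * (Matrix.of fun (i : Fin N) k => x i k) =
      Matrix.of fun (i : Fin N) k => x i k - if (i : ℕ) = 0 then 0 else φ * x (i - 1) k := by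
  ext i k
  have h : ∀ j : Fin N, stepMat N φ i j * x j k =
      (if i = j then x j k else 0) + (if (i : ℕ) = j + 1 then -(φ * x (i - 1) k) else 0) := by
    intro j
    rcases eq_or_ne i j with rfl | hij
    · simp [stepMat]
    · by_cases h : (i : ℕ) = j + 1
      · simp [stepMat, hij, h]
      · simp [stepMat, hij, h]
  simp only [Matrix.mul_apply, Matrix.of_apply, h, Finset.sum_add_distrib, Finset.sum_ite_eq,
    Finset.mem_univ, if_true]
  rw [sub_eq_add_neg]
  congr 1
  by_cases hi : (i : ℕ) = 0
  · simp [hi]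
  · rw [Finset.sum_eq_single ⟨(i : ℕ) - 1, by omega⟩]
    · simp only [hi, if_false]
      rw [if_pos (by omega)]
    · intro j _ hj
      rw [if_neg]
      intro h
      exact hj (Fin.ext (by simp; omega))
    · simp

theorem of_mul_stepMat {N : ℕ} {κ : Type*} (φ : R) (x : κ → ℕ → R) :
    (Matrix.of fun k (i : Fin N) => x k i) * stepMat N φ =
      Matrix.of fun k (i : Fin N) => x k i - if (i : ℕ) + 1 < N then x k (i + 1) * φ else 0 := by
  ext k i
  have h : ∀ j : Fin N, x k j * stepMat N φ j i =
      (if j = i then x k j else 0) + (if (j : ℕ) = i + 1 then -(x k (i + 1) * φ) else 0) := by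
    intro j
    rcases eq_or_ne j i with rfl | hij
    · simp [stepMat]
    · by_cases h : (j : ℕ) = i + 1
      · simp [stepMat, hij, h]
      · simp [stepMat, hij, h]
  simp only [Matrix.mul_apply, Matrix.of_apply, h, Finset.sum_add_distrib, Finset.sum_ite_eq',
    Finset.mem_univ, if_true]
  rw [sub_eq_add_neg]
  congr 1
  by_cases hi : (i : ℕ) + 1 < N
  · rw [Finset.sum_eq_single ⟨(i : ℕ) + 1, hi⟩]
    · simp [hi]
    · intro j _ hj
      rw [if_neg]
      intro h
      exact hj (Fin.ext (by simp; omega))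
    · simp
  · simp only [hi, if_false, neg_zero]
    refine Finset.sum_eq_zero fun j _ => if_neg ?_
    omega

theorem stepMat_mul_stepInv (N : ℕ) (φ : R) : stepMat N φ * stepInv N φ = 1 := by
  rw [stepInv, stepMat_mul_of φ fun i (j : Fin N) => if (j : ℕ) ≤ i then φ ^ (i - (j : ℕ)) else 0]
  ext i j
  simp only [Matrix.of_apply, Matrix.one_apply, Fin.ext_iff]
  rcases lt_trichotomy (i : ℕ) j with h | h | h
  · rw [if_neg (by omega), if_neg (show ¬ (j : ℕ) ≤ (i : ℕ) - 1 by omega),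
      if_neg (show ¬ (i : ℕ) = j by omega)]
    simp
  · simp only [h, le_refl, if_true, Nat.sub_self, pow_zero]
    by_cases h0 : (j : ℕ) = 0
    · simp [h0]
    · rw [if_neg h0, if_neg (by omega)]
      simp
  · rw [if_pos (by omega), if_neg (by omega), if_pos (by omega), if_neg (by omega), ← pow_succ',
      show (i : ℕ) - 1 - j + 1 = i - j by omega, sub_self]

/-- Inside an interval the powers of `φ` telescope. What survives is `1` at the C-point itself and
`-φ ^ m` at the next one, which is the Schur complement. -/
theorem stepMat_mul_interpMat {m N M : ℕ} (hm : 1 ≤ m) (hN : N = (M - 1) * m + 1) (φ : R) :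
    stepMat N φ * interpMat m N M φ = (injMat R m N M)ᵀ * stepMat M (φ ^ m) := by
  rw [interpMat, stepMat_mul_of φ fun i (q : Fin M) =>
    if (q : ℕ) * m ≤ i ∧ i < q * m + m then φ ^ (i - (q : ℕ) * m) else 0]
  have : (injMat R m N M)ᵀ = Matrix.of fun (i : Fin N) (q : Fin M) =>
      if (i : ℕ) = (q : ℕ) * m then (1 : R) else 0 := rfl
  rw [this, of_mul_stepMat (φ ^ m) fun (i : Fin N) q => if (i : ℕ) = q * m then (1 : R) else 0]
  ext i q
  simp only [Matrix.of_apply]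
  have hlast : (q : ℕ) + 1 < M ∨ (q : ℕ) + 1 = M := by omega
  have hq : (q : ℕ) + 1 < M → (q : ℕ) * m + m ≤ (M - 1) * m := fun h => by
    have := Nat.mul_le_mul_right m (show (q : ℕ) + 1 ≤ M - 1 by omega)
    rwa [add_mul, one_mul] at this
  have hq' : (q : ℕ) + 1 = M → (q : ℕ) * m = (M - 1) * m := fun h => by
    rw [show (q : ℕ) = M - 1 by omega]
  rw [show ((q : ℕ) + 1) * m = q * m + m by ring]
  have hi := i.2
  -- Only linear facts about these products are needed from here on, so they become atoms for
  -- `omega`.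
  generalize (q : ℕ) * m = c at *
  generalize (M - 1) * m = d at *
  rcases lt_trichotomy (i : ℕ) c with h | h | h
  · rw [if_neg (by omega), if_neg (show ¬ (c ≤ (i : ℕ) - 1 ∧ _) by omega),
      if_neg (show ¬ (i : ℕ) = c by omega), if_neg (show ¬ (i : ℕ) = c + m by omega)]
    simp
  · rw [if_pos (by omega), if_pos h, if_neg (show ¬ (i : ℕ) = c + m by omega)]
    by_cases h0 : (i : ℕ) = 0
    · simp [h0]
    · rw [if_neg (show ¬ (c ≤ (i : ℕ) - 1 ∧ _) by omega)]
      simp [h]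
  · rw [if_neg (show ¬ (i : ℕ) = 0 by omega), if_neg (show ¬ (i : ℕ) = c by omega)]
    rcases lt_trichotomy (i : ℕ) (c + m) with h' | h' | h'
    · rw [if_pos (by omega), if_pos (by omega), if_neg (show ¬ (i : ℕ) = c + m by omega),
        ← pow_succ', show (i : ℕ) - 1 - c + 1 = i - c by omega]
      simp
    · rw [if_neg (by omega), if_pos (by omega), if_pos (show (q : ℕ) + 1 < M by omega), if_pos h',
        ← pow_succ', show (i : ℕ) - 1 - c + 1 = m by omega]
      simp
    · rw [if_neg (by omega), if_neg (by omega), if_neg (show ¬ (i : ℕ) = c + m by omega)]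
      simp

theorem mul_lt_of_coarse {m N M : ℕ} (hN : N = (M - 1) * m + 1) (q : Fin M) : (q : ℕ) * m < N := by
  have := Nat.mul_le_mul_right m (show (q : ℕ) ≤ M - 1 by omega)
  omega

theorem mul_injMat_transpose_apply {m N M : ℕ} {κ : Type*} (hN : N = (M - 1) * m + 1)
    (X : Matrix κ (Fin N) R) (k : κ) (q : Fin M) :
    (X * (injMat R m N M)ᵀ) k q = X k ⟨q * m, mul_lt_of_coarse hN q⟩ := by
  rw [Matrix.mul_apply, Finset.sum_eq_single ⟨q * m, mul_lt_of_coarse hN q⟩]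
  · simp [injMat]
  · intro j _ hj
    have : (j : ℕ) ≠ q * m := fun h => hj (Fin.ext h)
    simp [injMat, this]
  · simp

theorem injMat_mul_apply {m N M : ℕ} {κ : Type*} (hN : N = (M - 1) * m + 1)
    (X : Matrix (Fin N) κ R) (k : κ) (q : Fin M) :
    (injMat R m N M * X) q k = X ⟨q * m, mul_lt_of_coarse hN q⟩ k := by
  rw [Matrix.mul_apply, Finset.sum_eq_single ⟨q * m, mul_lt_of_coarse hN q⟩]
  · simp [injMat]
  · intro j _ hj
    have : (j : ℕ) ≠ q * m := fun h => hj (Fin.ext h)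
    simp [injMat, this]
  · simp

theorem eq_of_mul_window {m p q : ℕ} (h₁ : p * m ≤ q * m) (h₂ : q * m < p * m + m) : p = q := by
  have hm : 0 < m := by omega
  have h₃ := Nat.le_of_mul_le_mul_right h₁ hm
  have h₄ : q * m < (p + 1) * m := by rw [add_mul, one_mul]; exact h₂
  have h₅ := Nat.lt_of_mul_lt_mul_right h₄
  omega

theorem restrictMat_mul_injMat_transpose {m N M : ℕ} (hm : 1 ≤ m) (hN : N = (M - 1) * m + 1)
    (φ : R) : restrictMat m N M φ * (injMat R m N M)ᵀ = 1 := by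
  ext q p
  rw [mul_injMat_transpose_apply hN, Matrix.one_apply]
  simp only [restrictMat, Matrix.of_apply]
  rcases eq_or_ne q p with rfl | h
  · rw [if_pos ⟨le_rfl, by omega⟩, if_pos rfl, Nat.sub_self, pow_zero]
  · rw [if_neg h, if_neg]
    rintro ⟨h₁, h₂⟩
    exact h (Fin.ext (eq_of_mul_window h₁ h₂).symm)

theorem injMat_mul_interpMat {m N M : ℕ} (hm : 1 ≤ m) (hN : N = (M - 1) * m + 1)
    (φ : R) : injMat R m N M * interpMat m N M φ = 1 := by
  ext q p
  rw [injMat_mul_apply hN, Matrix.one_apply]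
  simp only [interpMat, Matrix.of_apply]
  rcases eq_or_ne q p with rfl | h
  · rw [if_pos ⟨le_rfl, by omega⟩, if_pos rfl, Nat.sub_self, pow_zero]
  · rw [if_neg h, if_neg]
    rintro ⟨h₁, h₂⟩
    exact h (Fin.ext (eq_of_mul_window h₁ h₂).symm)

theorem not_dvd_of_div_eq {m i j : ℕ} (hj : ¬ m ∣ j) (hji : j ≤ i) (h : i / m = j / m) :
    ¬ m ∣ i := by
  intro hi
  have h₁ := Nat.div_mul_cancel hi
  have h₂ := Nat.div_mul_le_self j m
  rw [← h, h₁] at h₂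
  exact hj (le_antisymm hji h₂ ▸ hi)

/-- The columns of the F-solve are supported on F-points, and at an F-point two consecutive powers
in `R A` cancel. An F-point always has a successor, since the last time point is a C-point. -/
theorem restrictMat_mul_stepMat_mul_fSolveMat {m N M : ℕ} (hN : N = (M - 1) * m + 1)
    (φ : R) : restrictMat m N M φ * (stepMat N φ * fSolveMat m N φ) = 0 := by
  rw [← Matrix.mul_assoc, restrictMat, of_mul_stepMat φ fun (q : Fin M) i =>
    if i ≤ (q : ℕ) * m ∧ (q : ℕ) * m < i + m then φ ^ ((q : ℕ) * m - i) else 0]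
  ext q j
  rw [Matrix.mul_apply]
  refine Finset.sum_eq_zero fun i _ => ?_
  simp only [Matrix.of_apply, fSolveMat]
  by_cases hF : ¬ m ∣ (j : ℕ) ∧ (j : ℕ) ≤ i ∧ (i : ℕ) / m = j / m
  swap
  · rw [if_neg hF, mul_zero]
  have hd : ¬ m ∣ (i : ℕ) := not_dvd_of_div_eq hF.1 hF.2.1 hF.2.2
  have h₁ : (i : ℕ) ≠ q * m := fun h => hd (h ▸ dvd_mul_left _ _)
  have h₂ : (i : ℕ) ≠ (M - 1) * m := fun h => hd (h ▸ dvd_mul_left _ _)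
  have h₃ : (i : ℕ) + m ≠ q * m := fun h => hd <| by
    have : m ∣ (i : ℕ) + m := h ▸ dvd_mul_left _ _
    simpa using this
  rw [if_pos (show (i : ℕ) + 1 < N by omega)]
  by_cases hw : (i : ℕ) ≤ q * m ∧ (q : ℕ) * m < i + m
  · rw [if_pos hw, if_pos (by omega), ← pow_succ,
      show (q : ℕ) * m - (i + 1) + 1 = q * m - i by omega, sub_self, zero_mul]
  · rw [if_neg hw, if_neg (by omega)]
    simp

/-- Certifies the closed form in `fSolveMat`: `i` and `i - 1` lie in the same interval when `i` is
an F-point, so the powers telescope there. -/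
theorem stepMat_mul_fSolveMat_apply {m N : ℕ} (φ : R) (i j : Fin N)
    (hi : ¬ m ∣ (i : ℕ)) : (stepMat N φ * fSolveMat m N φ) i j = if i = j then 1 else 0 := by
  rw [fSolveMat, stepMat_mul_of φ fun i (j : Fin N) =>
    if ¬ m ∣ (j : ℕ) ∧ (j : ℕ) ≤ i ∧ i / m = j / m then φ ^ (i - (j : ℕ)) else 0]
  simp only [Matrix.of_apply]
  by_cases hj : m ∣ (j : ℕ)
  · have : i ≠ j := fun h => hi (h ▸ hj)
    simp [hj, this]
  simp only [hj, not_false_eq_true, true_and]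
  have h0 : (i : ℕ) ≠ 0 := fun h => hi (h ▸ dvd_zero m)
  have hm : ((i : ℕ) - 1) / m = i / m := by
    have := Nat.succ_div_of_not_dvd (a := (i : ℕ) - 1) (b := m)
      (by rwa [Nat.sub_add_cancel (by omega)])
    rw [Nat.sub_add_cancel (by omega)] at this
    exact this.symm
  rw [if_neg h0, hm]
  rcases lt_trichotomy (i : ℕ) j with h | h | h
  · rw [if_neg (by omega), if_neg (by omega), if_neg (by omega)]
    simp
  · obtain rfl := Fin.ext h
    rw [if_pos ⟨le_rfl, rfl⟩, if_neg (by omega)]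
    simp
  · rw [if_neg (show ¬ i = j by omega)]
    by_cases h' : (i : ℕ) / m = j / m
    · rw [if_pos ⟨h.le, h'⟩, if_pos ⟨by omega, h'⟩, ← pow_succ',
        show (i : ℕ) - 1 - j + 1 = i - j by omega, sub_self]
    · simp [h']

theorem fSolveMat_eq_zero_of_dvd_left {m N : ℕ} (φ : R) {i j : Fin N} (hi : m ∣ (i : ℕ)) :
    fSolveMat m N φ i j = 0 := by
  simp only [fSolveMat, Matrix.of_apply]
  exact if_neg fun h => not_dvd_of_div_eq h.1 h.2.1 h.2.2 hi

theorem fSolveMat_eq_zero_of_dvd_right {m N : ℕ} (φ : R) {i j : Fin N} (hj : m ∣ (j : ℕ)) :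
    fSolveMat m N φ i j = 0 := by
  simp [fSolveMat, hj]

/-! ### Naturality under ring homomorphisms -/

variable {R' : Type*} [Ring R'] (f : R →+* R')

/-- The same formulas make sense over matrices, over `Fin Nx → ℂ` and over `ℂ`. Naturality moves
between them along conjugation by `U`, the diagonal embedding and evaluation at a mode. -/
theorem map_stepMat (N : ℕ) (φ : R) : (stepMat N φ).map f = stepMat N (f φ) := by
  ext i j
  simp only [stepMat, Matrix.map_apply, Matrix.of_apply]
  split_ifs <;> simp

theorem map_stepInv (N : ℕ) (φ : R) : (stepInv N φ).map f = stepInv N (f φ) := by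
  ext i j
  simp only [stepInv, Matrix.map_apply, Matrix.of_apply]
  split_ifs <;> simp

theorem map_restrictMat (m N M : ℕ) (φ : R) :
    (restrictMat m N M φ).map f = restrictMat m N M (f φ) := by
  ext i j
  simp only [restrictMat, Matrix.map_apply, Matrix.of_apply]
  split_ifs <;> simp

theorem map_interpMat (m N M : ℕ) (φ : R) :
    (interpMat m N M φ).map f = interpMat m N M (f φ) := by
  ext i j
  simp only [interpMat, Matrix.map_apply, Matrix.of_apply]
  split_ifs <;> simp

theorem map_fSolveMat (m N : ℕ) (φ : R) : (fSolveMat m N φ).map f = fSolveMat m N (f φ) := by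
  ext i j
  simp only [fSolveMat, Matrix.map_apply, Matrix.of_apply]
  split_ifs <;> simp

/-- The approximate inverse realized by the level-1 cycle. -/
def coarseSolve (m N M : ℕ) (y z : R) : Matrix (Fin N) (Fin N) R :=
  interpMat m N M y * (stepInv M z * restrictMat m N M y) + fSolveMat m N y

theorem map_coarseSolve (m N M : ℕ) (y z : R) :
    (coarseSolve m N M y z).map f = coarseSolve m N M (f y) (f z) := by
  simp only [coarseSolve, Matrix.map_add f (map_add f), Matrix.map_mul, map_interpMat, map_stepInv,
    map_restrictMat, map_fSolveMat]

/-- The level-1 error propagator; `w` is the time step of the Schur complement. -/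
def errMat (m N M : ℕ) (w y z : R) : Matrix (Fin N) (Fin N) R :=
  1 - coarseSolve m N M y z * stepMat N w

/-- The level-1 residual propagator. -/
def resMat (m N M : ℕ) (w y z : R) : Matrix (Fin N) (Fin N) R :=
  1 - stepMat N w * coarseSolve m N M y z

theorem map_errMat (m N M : ℕ) (w y z : R) :
    (errMat m N M w y z).map f = errMat m N M (f w) (f y) (f z) := by
  simp only [errMat, Matrix.map_sub f (map_sub f), Matrix.map_mul, map_coarseSolve, map_stepMat,
    Matrix.map_one f (map_zero f) (map_one f)]

theorem map_resMat (m N M : ℕ) (w y z : R) :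
    (resMat m N M w y z).map f = resMat m N M (f w) (f y) (f z) := by
  simp only [resMat, Matrix.map_sub f (map_sub f), Matrix.map_mul, map_coarseSolve, map_stepMat,
    Matrix.map_one f (map_zero f) (map_one f)]

end Ring

/-! ### Entries of the level-1 propagators -/

section Entries

variable {R : Type*} [CommRing R]

theorem interpMat_mul_apply {m N M : ℕ} {κ : Type*} (φ : R) (X : Matrix (Fin M) κ R)
    (i : Fin N) (k : κ) (q : Fin M) {a : ℕ} (ha : a < m) (hi : (i : ℕ) = q * m + a) :
    (interpMat m N M φ * X) i k = φ ^ a * X q k := by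
  rw [Matrix.mul_apply, Finset.sum_eq_single q]
  · simp [interpMat, hi, ha]
  · intro p _ hp
    simp only [interpMat, Matrix.of_apply]
    rw [if_neg, zero_mul]
    rintro ⟨h₁, h₂⟩
    refine hp (Fin.ext ?_)
    rcases lt_trichotomy (p : ℕ) q with h | h | h
    · have := Nat.mul_le_mul_right m (show (p : ℕ) + 1 ≤ q from h)
      rw [add_mul, one_mul] at this
      omega
    · exact h
    · have := Nat.mul_le_mul_right m (show (q : ℕ) + 1 ≤ p from h)
      rw [add_mul, one_mul] at this
      omega
  · simp

theorem mul_restrictMat_apply {m N M : ℕ} {κ : Type*} (φ : R) (X : Matrix κ (Fin M) R)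
    (k : κ) (j : Fin N) (c : Fin M) (h₁ : (j : ℕ) ≤ c * m) (h₂ : (c : ℕ) * m < j + m) :
    (X * restrictMat m N M φ) k j = X k c * φ ^ ((c : ℕ) * m - j) := by
  rw [Matrix.mul_apply, Finset.sum_eq_single c]
  · simp [restrictMat, h₁, h₂]
  · intro p _ hp
    simp only [restrictMat, Matrix.of_apply]
    rw [if_neg, mul_zero]
    rintro ⟨h₃, h₄⟩
    refine hp (Fin.ext ?_)
    rcases lt_trichotomy (p : ℕ) c with h | h | h
    · have := Nat.mul_le_mul_right m (show (p : ℕ) + 1 ≤ c from h)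
      rw [add_mul, one_mul] at this
      omega
    · exact h
    · have := Nat.mul_le_mul_right m (show (c : ℕ) + 1 ≤ p from h)
      rw [add_mul, one_mul] at this
      omega
  · simp

theorem coarse_lt {m M q a : ℕ} (hm : 1 ≤ m) (hM : 1 ≤ M) (h : q * m + a < (M - 1) * m + 1) :
    q < M := by
  by_contra hq
  have := Nat.mul_le_mul_right m (show M - 1 + 1 ≤ q by omega)
  rw [add_mul, one_mul] at this
  omega

theorem mul_add_div_mod {m q a : ℕ} (ha : a < m) : (q * m + a) / m = q ∧ (q * m + a) % m = a := by
  constructor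
  · rw [mul_comm, Nat.mul_add_div (by omega), Nat.div_eq_of_lt ha, add_zero]
  · rw [mul_comm, Nat.mul_add_mod, Nat.mod_eq_of_lt ha]

theorem fSolveMat_apply {m N : ℕ} (y : R) (i j : Fin N) {q a p b : ℕ} (ha : a < m) (hb : b < m)
    (hb' : 1 ≤ b) (hi : (i : ℕ) = q * m + a) (hj : (j : ℕ) = p * m + b) :
    fSolveMat m N y i j = if p = q ∧ b ≤ a then y ^ (a - b) else 0 := by
  have hd : ¬ m ∣ (j : ℕ) := by
    rw [Nat.dvd_iff_mod_eq_zero, hj, (mul_add_div_mod hb).2]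
    omega
  simp only [fSolveMat, Matrix.of_apply, hd, not_false_eq_true, true_and]
  rw [hi, hj, (mul_add_div_mod ha).1, (mul_add_div_mod hb).1]
  by_cases h : q = p
  · subst h
    by_cases hab : b ≤ a
    · rw [if_pos ⟨by omega, rfl⟩, if_pos ⟨rfl, hab⟩, Nat.add_sub_add_left]
    · rw [if_neg (by omega), if_neg (by omega)]
  · rw [if_neg (by tauto), if_neg (by tauto)]

theorem coarseSolve_apply_zero {m N M : ℕ} (hm : 1 ≤ m) (hM : 1 ≤ M) (hN : N = (M - 1) * m + 1)
    (y z : R) (i j : Fin N) {q a p : ℕ} (ha : a < m) (hi : (i : ℕ) = q * m + a)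
    (hj : (j : ℕ) = p * m) :
    coarseSolve m N M y z i j = if p ≤ q then y ^ a * z ^ (q - p) else 0 := by
  have hq : q < M := coarse_lt hm hM (a := a) (by have := i.2; omega)
  have hp : p < M := coarse_lt hm hM (a := 0) (by have := j.2; omega)
  have hd : m ∣ (j : ℕ) := hj ▸ dvd_mul_left _ _
  rw [coarseSolve, Matrix.add_apply, fSolveMat_eq_zero_of_dvd_right y hd, add_zero,
    interpMat_mul_apply y _ i j ⟨q, hq⟩ ha hi,
    mul_restrictMat_apply y _ _ j ⟨p, hp⟩ (by simp [hj]) (by simp [hj]; omega)]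
  simp [stepInv, hj]

/-- The offset `b = m` is admitted and means the next C-point. Multiplying by `stepMat` brings in
column `j + 1`, which can then be treated without leaving interval `p`. -/
theorem coarseSolve_apply {m N M : ℕ} (hm : 1 ≤ m) (hM : 1 ≤ M) (hN : N = (M - 1) * m + 1)
    (y z : R) (i j : Fin N) {q a p b : ℕ} (ha : a < m) (hi : (i : ℕ) = q * m + a)
    (hj : (j : ℕ) = p * m + b) (hb : 1 ≤ b) (hb' : b ≤ m) :
    coarseSolve m N M y z i j = (if p < q then y ^ a * z ^ (q - p - 1) * y ^ (m - b) else 0) +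
      if p = q ∧ b ≤ a then y ^ (a - b) else 0 := by
  have hq : q < M := coarse_lt hm hM (a := a) (by have := i.2; omega)
  rcases eq_or_lt_of_le hb' with rfl | hb'
  · rw [coarseSolve_apply_zero hm hM hN y z i j ha hi (p := p + 1) (by rw [hj]; ring),
      if_neg (show ¬ (p = q ∧ b ≤ a) by omega)]
    simp [Nat.sub_sub]
  have hp : p + 1 < M := by
    have h := j.2
    by_contra h'
    have := Nat.mul_le_mul_right m (show M - 1 ≤ p by omega)
    omega
  rw [coarseSolve, Matrix.add_apply, fSolveMat_apply y i j ha hb' hb hi hj,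
    interpMat_mul_apply y _ i j ⟨q, hq⟩ ha hi,
    mul_restrictMat_apply y _ _ j ⟨p + 1, hp⟩ (by simp [hj, add_mul]; omega)
      (by simp [hj, add_mul]; omega)]
  congr 1
  simp only [stepInv, Matrix.of_apply, hj, add_mul, one_mul, Nat.add_sub_add_left,
    Nat.succ_le_iff, Nat.sub_sub]
  split_ifs <;> ring

/-- The factor with which column `b` of an interval acts on all later intervals. -/
def coupling (m : ℕ) (w y z : R) (b : ℕ) : R :=
  if b = 0 then z - w * y ^ (m - 1) else y ^ (m - 1 - b) * (y - w)

/-- The entry of the level-1 error propagator in row `q * m + a` and column `p * m + b`. -/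
def errEntry (m : ℕ) (w y z : R) (q a p b : ℕ) : R :=
  if p = q then if b < a then -((y - w) * y ^ (a - 1 - b)) else 0
  else if p < q then -(y ^ a * z ^ (q - p - 1) * coupling m w y z b) else 0

theorem mul_stepMat_apply {N : ℕ} (X : Matrix (Fin N) (Fin N) R) (w : R) (i j : Fin N) :
    (X * stepMat N w) i j =
      X i j - if h : (j : ℕ) + 1 < N then X i ⟨j + 1, h⟩ * w else 0 := by
  have h := congrFun (congrFun (of_mul_stepMat (N := N) w
    fun (i : Fin N) (j : ℕ) => if h : j < N then X i ⟨j, h⟩ else 0) i) j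
  simp only [Fin.is_lt, dite_true, Matrix.of_apply] at h
  refine Eq.trans ?_ (h.trans ?_)
  · rfl
  · congr 1
    split_ifs <;> rfl

theorem errMat_apply {m N M : ℕ} (hm : 1 ≤ m) (hM : 1 ≤ M) (hN : N = (M - 1) * m + 1)
    (w y z : R) (i j : Fin N) {q a p b : ℕ} (ha : a < m) (hb : b < m)
    (hi : (i : ℕ) = q * m + a) (hj : (j : ℕ) = p * m + b) :
    errMat m N M w y z i j = errEntry m w y z q a p b := by
  have hδ : (1 : Matrix (Fin N) (Fin N) R) i j = if p = q ∧ b = a then 1 else 0 := by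
    rw [Matrix.one_apply]
    refine if_congr ?_ rfl rfl
    rw [Fin.ext_iff, hi, hj]
    constructor
    · intro h
      have h₁ := mul_add_div_mod (q := q) ha
      have h₂ := mul_add_div_mod (q := p) hb
      rw [h] at h₁
      exact ⟨h₂.1.symm.trans h₁.1, h₂.2.symm.trans h₁.2⟩
    · rintro ⟨rfl, rfl⟩
      rfl
  have hq : q ≤ M - 1 := by
    have := coarse_lt hm hM (q := q) (a := a) (by have := i.2; omega)
    omega
  rw [errMat, Matrix.sub_apply, mul_stepMat_apply, hδ]
  have hj2 := j.2
  have hi2 := i.2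
  by_cases hlast : (j : ℕ) + 1 < N
  · rw [dif_pos hlast, coarseSolve_apply hm hM hN y z i ⟨j + 1, hlast⟩ ha hi
      (p := p) (b := b + 1) (by simp [hj]; omega) (by omega) (by omega)]
    rcases Nat.eq_zero_or_pos b with rfl | hb0
    · rw [coarseSolve_apply_zero hm hM hN y z i j ha hi (by simpa using hj)]
      simp only [errEntry, coupling, if_true]
      rcases lt_trichotomy p q with h | h | h
      · rw [if_neg (by omega), if_pos (by omega), if_pos h, if_neg (by omega), if_neg (by omega),
          if_pos h, zero_add, show q - p = q - p - 1 + 1 by omega, pow_succ]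
        simp only [Nat.add_sub_cancel]
        ring
      · subst h
        rcases Nat.eq_zero_or_pos a with rfl | ha0
        · simp
        · simp [ha0.ne, ha0, Nat.succ_le_iff.2 ha0]
          obtain ⟨a, rfl⟩ := Nat.exists_eq_add_of_le' ha0
          simp [pow_succ]
          ring
      · rw [if_neg (by omega), if_neg (by omega), if_neg (by omega), if_neg (by omega),
          if_neg (by omega), if_neg (by omega)]
        simp
    · rw [coarseSolve_apply hm hM hN y z i j ha hi hj hb0 hb.le]
      simp only [errEntry, coupling, hb0.ne', if_false]
      rcases lt_trichotomy p q with h | h | h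
      · rw [if_neg (by omega), if_pos h, if_neg (by omega), if_pos h, if_neg (by omega),
          if_neg (by omega), if_pos h, show m - b = m - 1 - b + 1 by omega,
          show m - (b + 1) = m - 1 - b by omega]
        ring
      · subst h
        rcases lt_trichotomy a b with h | h | h
        · simp [h.ne', h.not_ge, h.le.not_gt, show ¬ b + 1 ≤ a by omega]
        · subst h
          simp
        · simp [h.ne, h.le, h, Nat.succ_le_iff.2 h]
          obtain ⟨a, rfl⟩ := Nat.exists_eq_add_of_lt h
          simp [show b + a + 1 - b = a + 1 by omega, show b + a - b = a by omega,
            show b + a + 1 - (b + 1) = a by omega]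
          ring
      · rw [if_neg (by omega), if_neg (by omega), if_neg (by omega), if_neg (by omega),
          if_neg (by omega), if_neg (by omega), if_neg (by omega)]
        simp
  · have hp : ¬ p < M - 1 := fun h => by
      have := Nat.mul_le_mul_right m (show p + 1 ≤ M - 1 by omega)
      rw [add_mul, one_mul] at this
      omega
    have hp' := Nat.mul_le_mul_right m (show M - 1 ≤ p by omega)
    have hb0 : b = 0 := by omega
    subst hb0
    rw [dif_neg hlast, coarseSolve_apply_zero hm hM hN y z i j ha hi (by simpa using hj)]
    simp only [errEntry]
    rw [if_neg (show ¬ p < q by omega)]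
    by_cases h : p = q
    · subst h
      have : a = 0 := by omega
      subst this
      simp
    · rw [if_neg (by tauto), if_neg (by omega), if_neg h]
      simp

/-! ### Time reversal -/

theorem stepMat_rev {N : ℕ} (w : R) (i j : Fin N) :
    stepMat N w j.rev i.rev = stepMat N w i j := by
  have := i.2
  have := j.2
  simp only [stepMat, Matrix.of_apply, Fin.rev_inj, Fin.val_rev]
  refine if_congr (by tauto) rfl (if_congr (by omega) rfl rfl)

theorem stepInv_rev {N : ℕ} (w : R) (i j : Fin N) :
    stepInv N w j.rev i.rev = stepInv N w i j := by
  have := i.2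
  have := j.2
  simp only [stepInv, Matrix.of_apply, Fin.val_rev]
  rw [show N - (j + 1) - (N - ((i : ℕ) + 1)) = i - j by omega]
  exact if_congr (by omega) rfl rfl

/-- Because `N - 1` is a multiple of `m`, time reversal maps C-points to C-points. This makes it
exchange interpolation and restriction. -/
theorem rev_mul {m N M : ℕ} (hN : N = (M - 1) * m + 1) (q : Fin M) :
    (q.rev : ℕ) * m + q * m + 1 = N := by
  rw [hN, ← add_mul, Fin.val_rev, show M - ((q : ℕ) + 1) + q = M - 1 by omega]

theorem interpMat_rev {m N M : ℕ} (hN : N = (M - 1) * m + 1) (w : R) (i : Fin N) (q : Fin M) :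
    interpMat m N M w i.rev q.rev = restrictMat m N M w q i := by
  have := i.2
  have := rev_mul hN q
  simp only [interpMat, restrictMat, Matrix.of_apply, Fin.val_rev i]
  rw [show N - ((i : ℕ) + 1) - q.rev * m = q * m - i by omega]
  exact if_congr (by omega) rfl rfl

theorem restrictMat_rev {m N M : ℕ} (hN : N = (M - 1) * m + 1) (w : R) (i : Fin N) (q : Fin M) :
    restrictMat m N M w q.rev i.rev = interpMat m N M w i q := by
  rw [← interpMat_rev hN, Fin.rev_rev, Fin.rev_rev]

/-- Reversal sends the F-point with offset `r` in interval `Q` to offset `m - r` in interval `M - 2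
- Q`, so differences of offsets survive the swap of row and column. -/
theorem fSolveMat_rev {m N M : ℕ} (hm : 1 ≤ m) (hN : N = (M - 1) * m + 1) (w : R) (i j : Fin N) :
    fSolveMat m N w j.rev i.rev = fSolveMat m N w i j := by
  have hr : ∀ k : Fin N, (k.rev : ℕ) + k = (M - 1) * m := fun k => by
    have := k.2
    rw [Fin.val_rev]
    omega
  have hd : ∀ k : Fin N, m ∣ (k : ℕ) → m ∣ (k.rev : ℕ) := fun k hk =>
    (Nat.dvd_add_iff_left hk).2 (hr k ▸ dvd_mul_left _ _)
  by_cases hi : m ∣ (i : ℕ)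
  · rw [fSolveMat_eq_zero_of_dvd_left w hi, fSolveMat_eq_zero_of_dvd_right w (hd i hi)]
  by_cases hj : m ∣ (j : ℕ)
  · rw [fSolveMat_eq_zero_of_dvd_right w hj, fSolveMat_eq_zero_of_dvd_left w (hd j hj)]
  have key : ∀ k : Fin N, ¬ m ∣ (k : ℕ) → (k : ℕ) = (k : ℕ) / m * m + (k : ℕ) % m ∧
      (k : ℕ) % m < m ∧ 1 ≤ (k : ℕ) % m ∧ (k : ℕ) / m + 2 ≤ M ∧
      (k.rev : ℕ) = (M - 2 - (k : ℕ) / m) * m + (m - (k : ℕ) % m) := fun k hk => by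
    have h₁ := (Nat.div_add_mod' (k : ℕ) m).symm
    have h₂ := Nat.mod_lt (k : ℕ) hm
    have h₃ : (k : ℕ) % m ≠ 0 := fun h => hk (Nat.dvd_of_mod_eq_zero h)
    have h₄ := hr k
    generalize (k : ℕ) / m = Q at *
    generalize (k : ℕ) % m = r at *
    have h₅ : Q + 2 ≤ M := by
      by_contra h
      have := Nat.mul_le_mul_right m (show M - 1 ≤ Q by omega)
      omega
    refine ⟨h₁, h₂, by omega, h₅, ?_⟩
    rw [show M - 1 = (M - 2 - Q) + Q + 1 by omega, add_mul, add_mul,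
      one_mul] at h₄
    omega
  obtain ⟨hi₁, hi₂, hi₃, hi₄, hi₅⟩ := key i hi
  obtain ⟨hj₁, hj₂, hj₃, hj₄, hj₅⟩ := key j hj
  rw [fSolveMat_apply w j.rev i.rev (by omega) (by omega) (by omega) hj₅ hi₅,
    fSolveMat_apply w i j hi₂ hj₂ hj₃ hi₁ hj₁,
    show m - (j : ℕ) % m - (m - (i : ℕ) % m) = (i : ℕ) % m - (j : ℕ) % m by omega]
  exact if_congr (by omega) rfl rfl

theorem coarseSolve_rev {m N M : ℕ} (hm : 1 ≤ m) (hN : N = (M - 1) * m + 1) (y z : R)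
    (i j : Fin N) : coarseSolve m N M y z j.rev i.rev = coarseSolve m N M y z i j := by
  rw [coarseSolve, Matrix.add_apply, Matrix.add_apply, fSolveMat_rev hm hN, ← Matrix.mul_assoc]
  congr 1
  simp only [Matrix.mul_apply, Finset.sum_mul]
  rw [Finset.sum_comm, ← Equiv.sum_comp Fin.revPerm]
  refine Finset.sum_congr rfl fun p _ => ?_
  rw [← Equiv.sum_comp Fin.revPerm]
  refine Finset.sum_congr rfl fun q _ => ?_
  simp only [Fin.revPerm_apply]
  rw [interpMat_rev hN, restrictMat_rev hN, stepInv_rev]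
  ring

/-- Transposition reverses the order of the two factors, each of which is symmetric about the
antidiagonal. The entries must commute, so this is applied one mode at a time. -/
theorem resMat_eq_errMat_rev {m N M : ℕ} (hm : 1 ≤ m) (hN : N = (M - 1) * m + 1) (w y z : R)
    (i j : Fin N) : resMat m N M w y z i j = errMat m N M w y z j.rev i.rev := by
  simp only [resMat, errMat, Matrix.sub_apply, Matrix.one_apply, Fin.rev_inj, Matrix.mul_apply]
  congr 1
  · exact if_congr eq_comm rfl rfl
  rw [← Equiv.sum_comp Fin.revPerm]
  refine Finset.sum_congr rfl fun p _ => ?_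
  simp only [Fin.revPerm_apply]
  have h₁ := coarseSolve_rev hm hN y z p.rev j
  have h₂ := stepMat_rev w i p.rev
  rw [Fin.rev_rev] at h₁ h₂
  rw [← h₁, ← h₂, mul_comm]

end Entries

/-! ### Absolute row and column sums for one mode -/

theorem geo_eq_sum {z : ℂ} (hz : ‖z‖ < 1) (n : ℕ) : geo z n = ∑ k ∈ Finset.range n, ‖z‖ ^ k := by
  rw [geom_sum_eq hz.ne, geo, ← neg_sub, ← neg_sub (‖z‖), neg_div_neg_eq]

theorem geo_nonneg {z : ℂ} (hz : ‖z‖ < 1) (n : ℕ) : 0 ≤ geo z n := by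
  rw [geo_eq_sum hz]
  positivity

theorem geo_mono {z : ℂ} (hz : ‖z‖ < 1) : Monotone (geo z) := by
  refine monotone_nat_of_le_succ fun n => ?_
  rw [geo_eq_sum hz, geo_eq_sum hz, Finset.sum_range_succ]
  linarith [pow_nonneg (norm_nonneg z) n]

theorem one_le_geo {z : ℂ} (hz : ‖z‖ < 1) {n : ℕ} (hn : 1 ≤ n) : 1 ≤ geo z n := by
  have h : geo z 1 = 1 := by simp [geo_eq_sum hz]
  exact h ▸ geo_mono hz hn

theorem sum_range_mul_add (f : ℕ → ℝ) (n m : ℕ) :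
    ∑ i ∈ Finset.range (n * m), f i =
      ∑ q ∈ Finset.range n, ∑ a ∈ Finset.range m, f (q * m + a) := by
  induction n with
  | zero => simp
  | succ n ih => rw [add_mul, one_mul, Finset.sum_range_add, ih, Finset.sum_range_succ]

/-- The last interval consists of its C-point alone, whence the separate final term. -/
theorem sum_fin_intervals {m N M : ℕ} (hN : N = (M - 1) * m + 1) (f : Fin N → ℝ)
    (g : ℕ → ℕ → ℝ)
    (h : ∀ (i : Fin N) (q a : ℕ), a < m → (i : ℕ) = q * m + a → f i = g q a) (hm : 1 ≤ m) :
    ∑ i, f i = ∑ q ∈ Finset.range (M - 1), ∑ a ∈ Finset.range m, g q a + g (M - 1) 0 := by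
  have h' : ∀ i : Fin N, f i = (fun k => g (k / m) (k % m)) (i : ℕ) := fun i =>
    h i _ _ (Nat.mod_lt _ hm) (Nat.div_add_mod' _ _).symm
  rw [Finset.sum_congr rfl fun i _ => h' i,
    Fin.sum_univ_eq_sum_range (fun k => g (k / m) (k % m)) N, hN, Finset.sum_range_succ,
    sum_range_mul_add]
  congr 1
  · refine Finset.sum_congr rfl fun q _ => Finset.sum_congr rfl fun a ha => ?_
    have := mul_add_div_mod (q := q) (Finset.mem_range.1 ha)
    rw [this.1, this.2]
  · have := mul_add_div_mod (q := M - 1) (show 0 < m from hm)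
    rw [add_zero] at this
    rw [this.1, this.2]

theorem sum_range_ite_lt_pow (t : ℝ) (m b : ℕ) :
    ∑ a ∈ Finset.range m, (if b < a then t ^ (a - 1 - b) else 0) =
      ∑ k ∈ Finset.range (m - 1 - b), t ^ k := by
  rcases Nat.lt_or_ge b m with h | h
  · rw [show m = b + 1 + (m - 1 - b) by omega, Finset.sum_range_add, Finset.sum_eq_zero, zero_add,
      show b + 1 + (m - 1 - b) - 1 - b = m - 1 - b by omega]
    · refine Finset.sum_congr rfl fun k _ => ?_
      rw [if_pos (by omega), show b + 1 + k - 1 - b = k by omega]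
    · intro a ha
      rw [Finset.mem_range] at ha
      exact if_neg (by omega)
  · rw [show m - 1 - b = 0 by omega, Finset.sum_range_zero]
    refine Finset.sum_eq_zero fun a ha => ?_
    rw [Finset.mem_range] at ha
    exact if_neg (by omega)

theorem sum_range_ite_gt_pow (t : ℝ) {m a : ℕ} (ha : a ≤ m) :
    ∑ b ∈ Finset.range m, (if b < a then t ^ (a - 1 - b) else 0) =
      ∑ k ∈ Finset.range a, t ^ k := by
  rw [← Nat.add_sub_cancel' ha, Finset.sum_range_add, Finset.sum_eq_zero (s := .range (m - a)),
    add_zero, ← Finset.sum_range_reflect]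
  · refine Finset.sum_congr rfl fun b hb => ?_
    have := Finset.mem_range.1 hb
    rw [if_pos (by omega), show a - 1 - (a - 1 - b) = b by omega]
  · intro b _
    exact if_neg (by omega)

section Mode

variable (m : ℕ) (w y z : ℂ)

theorem norm_errEntry_self (q a b : ℕ) :
    ‖errEntry m w y z q a q b‖ = ‖y - w‖ * if b < a then ‖y‖ ^ (a - 1 - b) else 0 := by
  simp only [errEntry, if_true]
  split_ifs <;> simp

theorem norm_errEntry_of_lt {p q : ℕ} (h : p < q) (a b : ℕ) :
    ‖errEntry m w y z q a p b‖ = ‖y‖ ^ a * ‖z‖ ^ (q - p - 1) * ‖coupling m w y z b‖ := by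
  rw [errEntry, if_neg h.ne, if_pos h]
  simp

theorem errEntry_of_gt {p q : ℕ} (h : q < p) (a b : ℕ) : errEntry m w y z q a p b = 0 := by
  rw [errEntry, if_neg h.ne', if_neg h.not_gt]

theorem sum_norm_coupling (hy : ‖y‖ < 1) (hm : 1 ≤ m) :
    ∑ b ∈ Finset.range m, ‖coupling m w y z b‖ =
      ‖z - w * y ^ (m - 1)‖ + ‖y - w‖ * geo y (m - 1) := by
  obtain ⟨m, rfl⟩ := Nat.exists_eq_add_of_le' hm
  rw [Finset.sum_range_succ', add_comm, geo_eq_sum hy, Nat.add_sub_cancel,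
    ← Finset.sum_range_reflect, Finset.mul_sum]
  congr 1
  refine Finset.sum_congr rfl fun b hb => ?_
  have := Finset.mem_range.1 hb
  simp only [coupling, Nat.add_sub_cancel, Nat.add_one_ne_zero, if_false, norm_mul, norm_pow]
  rw [mul_comm, show m - (m - 1 - b + 1) = b by omega]

/-- Causality removes the intervals before `p`. The rest is the column's own interval, `M - 2 - p`
full later intervals, and the final C-point. -/
theorem sum_norm_errEntry_col (hy : ‖y‖ < 1) (hz : ‖z‖ < 1) {M p b : ℕ} (hp : p + 2 ≤ M) :
    ∑ q ∈ Finset.range (M - 1), ∑ a ∈ Finset.range m, ‖errEntry m w y z q a p b‖ +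
        ‖errEntry m w y z (M - 1) 0 p b‖ =
      ‖coupling m w y z b‖ * (‖z‖ ^ (M - 2 - p) + geo z (M - 2 - p) * geo y m) +
        ‖y - w‖ * geo y (m - 1 - b) := by
  rw [norm_errEntry_of_lt m w y z (by omega), show M - 1 = p + 1 + (M - 2 - p) by omega,
    Finset.sum_range_add, Finset.sum_range_succ, Finset.sum_eq_zero (s := .range p),
    geo_eq_sum hy (m - 1 - b), ← sum_range_ite_lt_pow, geo_eq_sum hz, geo_eq_sum hy,
    show p + 1 + (M - 2 - p) - p - 1 = M - 2 - p by omega]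
  · simp only [norm_errEntry_self, ← Finset.mul_sum]
    have h : ∀ x ∈ Finset.range (M - 2 - p),
        ∑ a ∈ Finset.range m, ‖errEntry m w y z (p + 1 + x) a p b‖ =
          ‖coupling m w y z b‖ * (‖z‖ ^ x * ∑ k ∈ Finset.range m, ‖y‖ ^ k) := fun x _ => by
      rw [Finset.mul_sum, Finset.mul_sum]
      refine Finset.sum_congr rfl fun a _ => ?_
      rw [norm_errEntry_of_lt m w y z (by omega), show p + 1 + x - p - 1 = x by omega]
      ring
    rw [Finset.sum_congr rfl h, ← Finset.mul_sum, ← Finset.sum_mul]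
    ring
  · intro q hq
    refine Finset.sum_eq_zero fun a _ => ?_
    rw [errEntry_of_gt m w y z (Finset.mem_range.1 hq), norm_zero]

theorem sum_norm_errEntry_col_last {M : ℕ} :
    ∑ q ∈ Finset.range (M - 1), ∑ a ∈ Finset.range m, ‖errEntry m w y z q a (M - 1) 0‖ +
        ‖errEntry m w y z (M - 1) 0 (M - 1) 0‖ = 0 := by
  rw [Finset.sum_eq_zero, norm_errEntry_self]
  · simp
  · intro q hq
    refine Finset.sum_eq_zero fun a _ => ?_
    rw [errEntry_of_gt m w y z (Finset.mem_range.1 hq), norm_zero]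

theorem sum_norm_errEntry_row (hy : ‖y‖ < 1) (hz : ‖z‖ < 1) (hm : 1 ≤ m) {M q a : ℕ}
    (ha : a < m) (hq : q + 2 ≤ M ∨ (q = M - 1 ∧ a = 0)) :
    ∑ p ∈ Finset.range (M - 1), ∑ b ∈ Finset.range m, ‖errEntry m w y z q a p b‖ +
        ‖errEntry m w y z q a (M - 1) 0‖ =
      ‖y - w‖ * geo y a + ‖y‖ ^ a * geo z q *
        (‖z - w * y ^ (m - 1)‖ + ‖y - w‖ * geo y (m - 1)) := by
  have hlt : ∑ p ∈ Finset.range q, ∑ b ∈ Finset.range m, ‖errEntry m w y z q a p b‖ =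
      ‖y‖ ^ a * geo z q * (‖z - w * y ^ (m - 1)‖ + ‖y - w‖ * geo y (m - 1)) := by
    rw [← sum_norm_coupling m w y z hy hm, geo_eq_sum hz, ← Finset.sum_range_reflect,
      Finset.mul_sum (Finset.range q), Finset.sum_mul]
    refine Finset.sum_congr rfl fun p hp => ?_
    have := Finset.mem_range.1 hp
    rw [Finset.mul_sum]
    refine Finset.sum_congr rfl fun b _ => ?_
    rw [norm_errEntry_of_lt m w y z (by omega), show q - (q - 1 - p) - 1 = p by omega]
  rcases hq with hq | ⟨rfl, rfl⟩
  · rw [errEntry_of_gt m w y z (show q < M - 1 by omega),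
      show M - 1 = q + 1 + (M - 2 - q) by omega,
      Finset.sum_range_add, Finset.sum_range_succ, hlt,
      Finset.sum_eq_zero (s := .range (M - 2 - q)), geo_eq_sum hy a,
      ← sum_range_ite_gt_pow _ ha.le]
    · simp only [norm_errEntry_self, ← Finset.mul_sum, norm_zero]
      ring
    · intro x _
      refine Finset.sum_eq_zero fun b _ => ?_
      rw [errEntry_of_gt m w y z (by omega), norm_zero]
  · rw [hlt, norm_errEntry_self]
    simp [geo]

end Mode

/-! ### The intervals where the sums are largest -/

section Bounds

variable {m₀ m M : ℕ} {x y z : ℂ}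

/-- Translates the numbering: `colSum` counts F-points backwards from the end of the interval, while
`b` is the offset from its start. -/
theorem colSum_eq {j : ℕ} {b : ℕ} (hb : b < m)
    (hj : j = if b = 0 then 0 else m - b) :
    colSum m₀ m M x y z j =
      ‖coupling m (x ^ m₀) y z b‖ * (‖z‖ ^ (M - 2) + geo z (M - 2) * geo y m) +
        ‖y - x ^ m₀‖ * geo y (m - 1 - b) := by
  subst hj
  rcases Nat.eq_zero_or_pos b with rfl | h
  · simp [colSum, coupling]
  · rw [if_neg h.ne', colSum, if_neg (by omega), coupling, if_neg h.ne', norm_mul, norm_pow,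
      show m - b - 1 = m - 1 - b by omega]

theorem rowSum_zero : rowSum m₀ m M x y z 0 =
    geo z (M - 1) * (‖z - x ^ m₀ * y ^ (m - 1)‖ + ‖y - x ^ m₀‖ * geo y (m - 1)) := by
  simp only [rowSum, if_true]
  ring

theorem rowSum_pos {a : ℕ} (ha : a ≠ 0) : rowSum m₀ m M x y z a =
    ‖y - x ^ m₀‖ * geo y a + ‖y‖ ^ a * geo z (M - 2) *
        (‖z - x ^ m₀ * y ^ (m - 1)‖ + ‖y - x ^ m₀‖ * geo y (m - 1)) := by
  simp only [rowSum, ha, if_false]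
  ring

/-- One more interval loses `‖z‖ ^ n` but gains `‖z‖ ^ n * geo y m`, and `geo y m ≥ 1`. This is why
the first interval has the largest column sums. -/
theorem interval_growth_mono (hy : ‖y‖ < 1) (hz : ‖z‖ < 1) (hm : 1 ≤ m) :
    Monotone fun n => ‖z‖ ^ n + geo z n * geo y m := by
  refine monotone_nat_of_le_succ fun n => ?_
  simp only [geo_eq_sum hz, Finset.sum_range_succ, pow_succ]
  have h₁ := one_le_geo hy hm
  have h₂ := pow_nonneg (norm_nonneg z) n
  have h₃ := norm_nonneg z
  nlinarith [mul_nonneg h₂ (sub_nonneg.2 h₁), mul_nonneg h₂ h₃]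

variable {N : ℕ}

theorem exists_interval (hm : 1 ≤ m) (hM : 1 ≤ M) (hN : N = (M - 1) * m + 1) (i : Fin N) :
    ∃ q a, a < m ∧ (i : ℕ) = q * m + a ∧ (q + 2 ≤ M ∨ (q = M - 1 ∧ a = 0)) := by
  refine ⟨(i : ℕ) / m, (i : ℕ) % m, Nat.mod_lt _ hm, (Nat.div_add_mod' _ _).symm, ?_⟩
  have h := (Nat.div_add_mod' (i : ℕ) m).symm
  have hi := i.2
  generalize (i : ℕ) / m = q at *
  generalize (i : ℕ) % m = a at *
  have hq : q < M := coarse_lt hm hM (a := a) (by omega)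
  rcases Nat.lt_or_ge (q + 1) M with h' | h'
  · exact Or.inl h'
  · obtain rfl : q = M - 1 := by omega
    exact Or.inr ⟨rfl, by omega⟩

theorem exists_col_le (hy : ‖y‖ < 1) (hz : ‖z‖ < 1) (hm : 1 ≤ m) (hM : 2 ≤ M)
    (hN : N = (M - 1) * m + 1) (j : Fin N) : ∃ b : Fin m,
    ∑ i, ‖errMat m N M (x ^ m₀) y z i j‖ ≤ colSum m₀ m M x y z b := by
  obtain ⟨p, b, hb, hj, hp⟩ := exists_interval hm (by omega) hN j
  refine ⟨⟨if b = 0 then 0 else m - b, by split_ifs <;> omega⟩, ?_⟩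
  rw [colSum_eq hb rfl, sum_fin_intervals hN _ _ (fun i q a ha hi => by
    rw [errMat_apply hm (by omega) hN (x ^ m₀) y z i j ha hb hi hj]) hm]
  rcases hp with hp | ⟨rfl, rfl⟩
  · rw [sum_norm_errEntry_col m _ y z hy hz hp]
    have := interval_growth_mono hy hz hm (show M - 2 - p ≤ M - 2 by omega)
    simp only at this
    gcongr
  · rw [sum_norm_errEntry_col_last]
    have := geo_nonneg hy m
    have := geo_nonneg hz (M - 2)
    have := geo_nonneg hy (m - 1 - 0)
    positivity

theorem exists_col_eq (hy : ‖y‖ < 1) (hz : ‖z‖ < 1) (hm : 1 ≤ m) (hM : 2 ≤ M)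
    (hN : N = (M - 1) * m + 1) (c : Fin m) : ∃ j : Fin N,
    ∑ i, ‖errMat m N M (x ^ m₀) y z i j‖ = colSum m₀ m M x y z c := by
  obtain ⟨b, hb, hc⟩ : ∃ b, b < m ∧ (c : ℕ) = if b = 0 then 0 else m - b := by
    have := c.2
    rcases Nat.eq_zero_or_pos (c : ℕ) with h | h
    · exact ⟨0, hm, by simp [h]⟩
    · exact ⟨m - c, by omega, by rw [if_neg (by omega)]; omega⟩
  have hj : b < N := by
    have := Nat.mul_le_mul_right m (show 1 ≤ M - 1 by omega)
    omega
  refine ⟨⟨b, hj⟩, ?_⟩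
  rw [colSum_eq hb hc, sum_fin_intervals hN _ _ (fun i q a ha hi => by
    rw [errMat_apply hm (by omega) hN (x ^ m₀) y z i ⟨b, hj⟩ ha hb hi (p := 0) (by simp)]) hm,
    sum_norm_errEntry_col m _ y z hy hz (by omega)]
  simp

/-- A C-point row has at most `M - 1` intervals before it, an F-point row at most `M - 2`, because
the last C-point is followed by no F-point. -/
theorem exists_row_le (hy : ‖y‖ < 1) (hz : ‖z‖ < 1) (hm : 1 ≤ m) (hM : 2 ≤ M)
    (hN : N = (M - 1) * m + 1) (i : Fin N) : ∃ a : Fin m,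
    ∑ j, ‖errMat m N M (x ^ m₀) y z i j‖ ≤ rowSum m₀ m M x y z a := by
  obtain ⟨q, a, ha, hi, hq⟩ := exists_interval hm (by omega) hN i
  refine ⟨⟨a, ha⟩, ?_⟩
  rw [sum_fin_intervals hN _ _ (fun j p b hb hj => by
    rw [errMat_apply hm (by omega) hN (x ^ m₀) y z i j ha hb hi hj]) hm,
    sum_norm_errEntry_row m _ y z hy hz hm ha hq]
  have h₁ := geo_nonneg hy (m - 1)
  rcases Nat.eq_zero_or_pos a with rfl | h
  · have h₂ := geo_mono hz (show q ≤ M - 1 by omega)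
    simp only [rowSum_zero, pow_zero, one_mul]
    rw [show geo y 0 = 0 by simp [geo], mul_zero, zero_add]
    gcongr
  · have h₂ := geo_mono hz (show q ≤ M - 2 by omega)
    rw [rowSum_pos h.ne']
    gcongr

theorem exists_row_eq (hy : ‖y‖ < 1) (hz : ‖z‖ < 1) (hm : 1 ≤ m) (hM : 2 ≤ M)
    (hN : N = (M - 1) * m + 1) (a : Fin m) : ∃ i : Fin N,
    ∑ j, ‖errMat m N M (x ^ m₀) y z i j‖ = rowSum m₀ m M x y z a := by
  obtain ⟨q, hq, hqa⟩ : ∃ q, (q + 2 ≤ M ∨ (q = M - 1 ∧ (a : ℕ) = 0)) ∧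
      q = if (a : ℕ) = 0 then M - 1 else M - 2 := by
    by_cases h : (a : ℕ) = 0
    · exact ⟨M - 1, Or.inr ⟨rfl, h⟩, by simp [h]⟩
    · exact ⟨M - 2, Or.inl (by omega), by simp [h]⟩
  have hi : q * m + a < N := by
    rcases hq with hq | ⟨rfl, ha⟩
    · have := Nat.mul_le_mul_right m (show q + 1 ≤ M - 1 by omega)
      rw [add_mul, one_mul] at this
      omega
    · omega
  refine ⟨⟨q * m + a, hi⟩, ?_⟩
  rw [sum_fin_intervals hN _ _ (fun j p b hb hj => by
    rw [errMat_apply hm (by omega) hN (x ^ m₀) y z ⟨q * m + a, hi⟩ j a.2 hb rfl hj]) hm,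
    sum_norm_errEntry_row m _ y z hy hz hm a.2 hq]
  by_cases h : (a : ℕ) = 0
  · rw [h, rowSum_zero, hqa, if_pos h]
    simp [geo]
  · rw [rowSum_pos h, hqa, if_neg h]

end Bounds

/-! ### Block operators -/

section Block

variable {N M K Nx : ℕ}

/-- The space-time operator with the given matrix of blocks. -/
def blockMat (X : Matrix (Fin N) (Fin M) (Matrix (Fin Nx) (Fin Nx) ℂ)) : Op N M Nx := block X

theorem blockMat_apply (X : Matrix (Fin N) (Fin M) (Matrix (Fin Nx) (Fin Nx) ℂ))
    (p : Fin N × Fin Nx) (q : Fin M × Fin Nx) : blockMat X p q = X p.1 q.1 p.2 q.2 := rfl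

theorem blockMat_mul (X : Matrix (Fin N) (Fin M) (Matrix (Fin Nx) (Fin Nx) ℂ))
    (Y : Matrix (Fin M) (Fin K) (Matrix (Fin Nx) (Fin Nx) ℂ)) :
    blockMat (X * Y) = blockMat X * blockMat Y := by
  ext p q
  simp only [blockMat_apply, Matrix.mul_apply, Matrix.sum_apply, Fintype.sum_prod_type]

theorem blockMat_one :
    blockMat (1 : Matrix (Fin N) (Fin N) (Matrix (Fin Nx) (Fin Nx) ℂ)) = 1 := by
  ext ⟨i, k⟩ ⟨j, l⟩
  simp only [blockMat_apply, Matrix.one_apply, Prod.mk.injEq]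
  by_cases h : i = j <;> simp [h, Matrix.one_apply]

theorem blockMat_sub (X Y : Matrix (Fin N) (Fin M) (Matrix (Fin Nx) (Fin Nx) ℂ)) :
    blockMat (X - Y) = blockMat X - blockMat Y := rfl

theorem blockMat_add (X Y : Matrix (Fin N) (Fin M) (Matrix (Fin Nx) (Fin Nx) ℂ)) :
    blockMat (X + Y) = blockMat X + blockMat Y := rfl

theorem blockMat_zero :
    blockMat (0 : Matrix (Fin N) (Fin M) (Matrix (Fin Nx) (Fin Nx) ℂ)) = 0 := rfl

variable (Φ : Matrix (Fin Nx) (Fin Nx) ℂ)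

theorem timeMat_eq : timeMat N Φ = blockMat (stepMat N Φ) := rfl

theorem idealRestrict_eq (m : ℕ) : idealRestrict m N M Φ = blockMat (restrictMat m N M Φ) := rfl

theorem idealInterp_eq (m : ℕ) : idealInterp m N M Φ = blockMat (interpMat m N M Φ) := rfl

theorem injRestrict_eq (m : ℕ) : injRestrict m N M Nx = blockMat (injMat _ m N M) := rfl

theorem injRestrict_transpose_eq (m : ℕ) :
    (injRestrict m N M Nx)ᵀ = blockMat (injMat (Matrix (Fin Nx) (Fin Nx) ℂ) m N M)ᵀ := by
  ext ⟨i, k⟩ ⟨j, l⟩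
  simp only [injRestrict_eq, Matrix.transpose_apply, blockMat_apply, injMat, Matrix.of_apply]
  split_ifs
  · simp only [Matrix.one_apply, eq_comm]
  · simp

theorem timeMat_inv : (timeMat N Φ)⁻¹ = blockMat (stepInv N Φ) :=
  Matrix.inv_eq_right_inv (by rw [timeMat_eq, ← blockMat_mul, stepMat_mul_stepInv, blockMat_one])

/-- The index of an F-point unknown among all unknowns. -/
def fIndex (m N Nx : ℕ) (q : FPoint m N × Fin Nx) : Fin N × Fin Nx := (q.1.1, q.2)

theorem fEmbed_eq (m : ℕ) :
    fEmbed m N Nx = (1 : Op N N Nx).submatrix id (fIndex m N Nx) := by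
  ext p q
  simp [fEmbed, fIndex, Matrix.one_apply, Prod.ext_iff]

theorem fEmbed_transpose_mul (m : ℕ) {κ : Type*} (X : Matrix (Fin N × Fin Nx) κ ℂ) :
    (fEmbed m N Nx)ᵀ * X = X.submatrix (fIndex m N Nx) id := by
  ext p q
  simp [fEmbed_eq, Matrix.mul_apply, Matrix.one_apply]

theorem mul_fEmbed (m : ℕ) {κ : Type*} (X : Matrix κ (Fin N × Fin Nx) ℂ) :
    X * fEmbed m N Nx = X.submatrix id (fIndex m N Nx) := by
  ext p q
  simp [fEmbed_eq, Matrix.mul_apply, Matrix.one_apply]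

theorem fEmbed_mul_transpose (m : ℕ) :
    fEmbed m N Nx * (fEmbed m N Nx)ᵀ =
      Matrix.diagonal fun p : Fin N × Fin Nx => if m ∣ (p.1 : ℕ) then 0 else 1 := by
  ext p q
  rw [Matrix.mul_apply, Matrix.diagonal_apply]
  simp only [fEmbed_eq, Matrix.submatrix_apply, Matrix.transpose_apply, id, Matrix.one_apply]
  by_cases h : m ∣ (p.1 : ℕ)
  · rw [if_pos h, ite_self]
    refine Finset.sum_eq_zero fun x _ => ?_
    rw [if_neg, zero_mul]
    rintro rfl
    exact x.1.2 h
  · rw [Finset.sum_eq_single ⟨⟨p.1, h⟩, p.2⟩]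
    · simp [fIndex, h, eq_comm]
    · intro x _ hx
      rw [if_neg, zero_mul]
      rintro rfl
      exact hx rfl
    · simp

/-- `S Sᵀ` is the projection onto the F-points and fixes the closed form from both sides. Its
compression is therefore the inverse of `Sᵀ A S`, and embedding it back loses nothing. -/
theorem fSolve_eq (m : ℕ) : fSolve m N Φ = blockMat (fSolveMat m N Φ) := by
  have hF : fEmbed m N Nx * (fEmbed m N Nx)ᵀ * blockMat (fSolveMat m N Φ) =
      blockMat (fSolveMat m N Φ) := by
    ext p q
    rw [fEmbed_mul_transpose, Matrix.diagonal_mul]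
    split_ifs with h
    · rw [blockMat_apply, fSolveMat_eq_zero_of_dvd_left Φ h, Matrix.zero_apply, mul_zero]
    · rw [one_mul]
  have hF' : blockMat (fSolveMat m N Φ) * (fEmbed m N Nx * (fEmbed m N Nx)ᵀ) =
      blockMat (fSolveMat m N Φ) := by
    ext p q
    rw [fEmbed_mul_transpose, Matrix.mul_diagonal]
    split_ifs with h
    · rw [blockMat_apply, fSolveMat_eq_zero_of_dvd_right Φ h, Matrix.zero_apply, mul_zero]
    · rw [mul_one]
  have hinv : (fEmbed m N Nx)ᵀ * timeMat N Φ * fEmbed m N Nx *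
      ((fEmbed m N Nx)ᵀ * blockMat (fSolveMat m N Φ) * fEmbed m N Nx) = 1 := by
    calc _ = (fEmbed m N Nx)ᵀ * (timeMat N Φ *
          (fEmbed m N Nx * (fEmbed m N Nx)ᵀ * blockMat (fSolveMat m N Φ))) * fEmbed m N Nx := by
          simp only [Matrix.mul_assoc]
      _ = 1 := by
          rw [hF, timeMat_eq, ← blockMat_mul, fEmbed_transpose_mul, mul_fEmbed]
          ext p q
          have := stepMat_mul_fSolveMat_apply Φ p.1.1 q.1.1 p.1.2
          simp only [Matrix.submatrix_apply, id, blockMat_apply, fIndex, this, Matrix.one_apply,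
            Prod.ext_iff, Subtype.ext_iff]
          by_cases h : p.1.1 = q.1.1 <;> simp [h, Matrix.one_apply]
  rw [fSolve, Matrix.inv_eq_right_inv hinv]
  calc _ = fEmbed m N Nx * (fEmbed m N Nx)ᵀ * blockMat (fSolveMat m N Φ) *
        (fEmbed m N Nx * (fEmbed m N Nx)ᵀ) := by simp only [Matrix.mul_assoc]
    _ = _ := by rw [hF, hF']

end Block

/-! ### Residual propagation through the V-cycle -/

section Cycle

variable {m₀ m₁ N₀ N₁ N₂ Nx : ℕ} (Φ : Fin 3 → Matrix (Fin Nx) (Fin Nx) ℂ)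

theorem idealRestrict_mul_timeMat_mul_idealInterp (hm₀ : 1 ≤ m₀) (hN₀ : N₀ = (N₁ - 1) * m₀ + 1) :
    idealRestrict m₀ N₀ N₁ (Φ 0) * (timeMat N₀ (Φ 0) * idealInterp m₀ N₀ N₁ (Φ 0)) =
      timeMat N₁ (Φ 0 ^ m₀) := by
  rw [timeMat_eq, idealInterp_eq, ← blockMat_mul, stepMat_mul_interpMat hm₀ hN₀, idealRestrict_eq,
    ← blockMat_mul, ← Matrix.mul_assoc, restrictMat_mul_injMat_transpose hm₀ hN₀, Matrix.one_mul,
    timeMat_eq]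

theorem errPropCoarse_eq (hm₀ : 1 ≤ m₀) (hN₀ : N₀ = (N₁ - 1) * m₀ + 1) :
    errPropCoarse m₀ m₁ N₀ N₁ N₂ Φ =
      blockMat (errMat m₁ N₁ N₂ (Φ 0 ^ m₀) (Φ 1) (Φ 2)) := by
  have h₁ : injRestrict m₀ N₀ N₁ Nx * idealInterp m₀ N₀ N₁ (Φ 0) = 1 := by
    rw [injRestrict_eq, idealInterp_eq, ← blockMat_mul, injMat_mul_interpMat hm₀ hN₀, blockMat_one]
  have h₂ := idealRestrict_mul_timeMat_mul_idealInterp Φ hm₀ hN₀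
  calc errPropCoarse m₀ m₁ N₀ N₁ N₂ Φ
      = (injRestrict m₀ N₀ N₁ Nx * idealInterp m₀ N₀ N₁ (Φ 0)) *
          (1 - (idealInterp m₁ N₁ N₂ (Φ 1) * ((timeMat N₂ (Φ 2))⁻¹ *
            idealRestrict m₁ N₁ N₂ (Φ 1)) + fSolve m₁ N₁ (Φ 1)) *
            (idealRestrict m₀ N₀ N₁ (Φ 0) * (timeMat N₀ (Φ 0) * idealInterp m₀ N₀ N₁ (Φ 0)))) *
          (injRestrict m₀ N₀ N₁ Nx * idealInterp m₀ N₀ N₁ (Φ 0)) := by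
        simp only [errPropCoarse, errProp, Matrix.mul_sub, Matrix.sub_mul, Matrix.mul_add,
          Matrix.add_mul, Matrix.mul_assoc, Matrix.one_mul, sub_sub]
    _ = _ := by
        rw [h₁, h₂, Matrix.one_mul, Matrix.mul_one, timeMat_inv, idealInterp_eq, idealRestrict_eq,
          fSolve_eq, timeMat_eq, errMat, coarseSolve, blockMat_sub, blockMat_one, blockMat_mul,
          blockMat_add, blockMat_mul, blockMat_mul]

theorem levelOneCycle_eq (hN₁ : N₁ = (N₂ - 1) * m₁ + 1) (g : Vec N₁ Nx) :
    levelOneCycle m₁ N₁ N₂ Φ g = blockMat (coarseSolve m₁ N₁ N₂ (Φ 1) (Φ 2)) *ᵥ g := by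
  have h : idealRestrict m₁ N₁ N₂ (Φ 1) *ᵥ (timeMat N₁ (Φ 1) *ᵥ (fSolve m₁ N₁ (Φ 1) *ᵥ g)) = 0 := by
    rw [Matrix.mulVec_mulVec, Matrix.mulVec_mulVec, fSolve_eq, timeMat_eq, idealRestrict_eq,
      ← blockMat_mul, ← blockMat_mul, Matrix.mul_assoc,
      restrictMat_mul_stepMat_mul_fSolveMat hN₁, blockMat_zero,
      Matrix.zero_mulVec]
  simp only [levelOneCycle, fRelax, residual, Matrix.mulVec_zero, sub_zero, zero_add,
    Matrix.mulVec_sub (idealRestrict m₁ N₁ N₂ (Φ 1)), h]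
  rw [coarseSolve, blockMat_add, blockMat_mul, blockMat_mul, Matrix.add_mulVec, fSolve_eq,
    idealRestrict_eq, idealInterp_eq, timeMat_inv, Matrix.mulVec_mulVec, Matrix.mulVec_mulVec,
    add_comm, Matrix.mul_assoc]

theorem residual_add {N : ℕ} (Ψ : Matrix (Fin Nx) (Fin Nx) ℂ) (g u v : Vec N Nx) :
    residual Ψ g (u + v) = residual Ψ g u - timeMat N Ψ *ᵥ v := by
  rw [residual, residual, Matrix.mulVec_add, sub_sub]

theorem residual_fRelax_apply (m : ℕ) {N : ℕ} (Ψ : Matrix (Fin Nx) (Fin Nx) ℂ) (g u : Vec N Nx)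
    (p : Fin N × Fin Nx) (hp : ¬ m ∣ (p.1 : ℕ)) : residual Ψ g (fRelax m Ψ g u) p = 0 := by
  rw [fRelax, residual_add, Matrix.mulVec_mulVec, fSolve_eq, timeMat_eq, ← blockMat_mul,
    Pi.sub_apply, sub_eq_zero]
  have : ∀ q : Fin N × Fin Nx, blockMat (stepMat N Ψ * fSolveMat m N Ψ) p q =
      (1 : Op N N Nx) p q := fun q => by
    rw [blockMat_apply, stepMat_mul_fSolveMat_apply Ψ p.1 q.1 hp, ← blockMat_one, blockMat_apply,
      Matrix.one_apply]
  simp only [Matrix.mulVec, dotProduct, this, Matrix.one_apply, ite_mul, one_mul, zero_mul,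
    Finset.sum_ite_eq, Finset.mem_univ, if_true]

/-- The C-point columns of the F-solve vanish, so it sees only the residual at F-points. -/
theorem fRelax_eq_self (m : ℕ) {N : ℕ} (Ψ : Matrix (Fin Nx) (Fin Nx) ℂ) (g u : Vec N Nx)
    (h : ∀ p : Fin N × Fin Nx, ¬ m ∣ (p.1 : ℕ) → residual Ψ g u p = 0) :
    fRelax m Ψ g u = u := by
  rw [fRelax, fSolve_eq, add_eq_left]
  ext p
  refine Finset.sum_eq_zero fun q _ => ?_
  by_cases hq : m ∣ (q.1 : ℕ)
  · simp only [blockMat_apply, fSolveMat_eq_zero_of_dvd_right Ψ hq, Matrix.zero_apply, zero_mul]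
  · rw [h q hq, mul_zero]

/-- The space-time vector with values `σ` at the C-points and zero at the F-points. -/
def atCPoints (m N : ℕ) {M Nx : ℕ} (σ : Vec M Nx) : Vec N Nx := (injRestrict m N M Nx)ᵀ *ᵥ σ

theorem atCPoints_apply_mul {m N M : ℕ} (hm : 1 ≤ m) (σ : Vec M Nx) (i : Fin N) (q : Fin M)
    (h : (i : ℕ) = q * m) (k : Fin Nx) : atCPoints m N σ (i, k) = σ (q, k) := by
  have : ∀ p : Fin M × Fin Nx, (injRestrict m N M Nx)ᵀ (i, k) p =
      if p = (q, k) then 1 else 0 := fun ⟨p, l⟩ => by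
    simp only [Matrix.transpose_apply, injRestrict, block, Matrix.of_apply, h, Prod.mk.injEq]
    by_cases hpq : p = q
    · simp [hpq, Matrix.one_apply]
    · have : (q : ℕ) * m ≠ p * m := fun h => hpq (Fin.ext (Nat.eq_of_mul_eq_mul_right hm h).symm)
      simp [hpq, this]
  simp only [atCPoints, Matrix.mulVec, dotProduct, this, ite_mul, one_mul, zero_mul,
    Finset.sum_ite_eq', Finset.mem_univ, if_true]

theorem atCPoints_apply_of_not_dvd {m N M : ℕ} (σ : Vec M Nx) (p : Fin N × Fin Nx)
    (h : ¬ m ∣ (p.1 : ℕ)) : atCPoints m N σ p = 0 := by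
  refine Finset.sum_eq_zero fun q _ => ?_
  have : (p.1 : ℕ) ≠ q.1 * m := fun h' => h (h' ▸ dvd_mul_left _ _)
  simp [injRestrict, block, this]

theorem exists_eq_atCPoints {m N M : ℕ} (hm : 1 ≤ m) (hM : 1 ≤ M) (hN : N = (M - 1) * m + 1)
    (r : Vec N Nx) (h : ∀ p : Fin N × Fin Nx, ¬ m ∣ (p.1 : ℕ) → r p = 0) :
    ∃ σ : Vec M Nx, r = atCPoints m N σ := by
  refine ⟨fun p => r (⟨p.1 * m, mul_lt_of_coarse hN p.1⟩, p.2), ?_⟩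
  ext ⟨i, k⟩
  by_cases hi : m ∣ (i : ℕ)
  · obtain ⟨q, hq⟩ := hi
    rw [mul_comm] at hq
    have hqM : q < M := coarse_lt hm hM (a := 0) (by have := i.2; omega)
    rw [atCPoints_apply_mul hm _ i ⟨q, hqM⟩ hq]
    congr 2
    exact Fin.ext hq
  · rw [h _ hi, atCPoints_apply_of_not_dvd _ _ hi]

/-- The coarse correction changes the residual by `A₀ P₀ v`, which is supported on the C-points, so
the F-point residual stays zero and only `σ` evolves. -/
theorem residual_vCycle (hm₀ : 1 ≤ m₀) (hN₁ : N₁ = (N₂ - 1) * m₁ + 1)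
    (hN₀ : N₀ = (N₁ - 1) * m₀ + 1) (g u : Vec N₀ Nx) (σ : Vec N₁ Nx)
    (h : residual (Φ 0) g (fRelax m₀ (Φ 0) g u) = atCPoints m₀ N₀ σ) :
    residual (Φ 0) g (vCycle m₀ m₁ N₀ N₁ N₂ Φ g u) =
      atCPoints m₀ N₀ (blockMat (resMat m₁ N₁ N₂ (Φ 0 ^ m₀) (Φ 1) (Φ 2)) *ᵥ σ) := by
  have hA : timeMat N₀ (Φ 0) * idealInterp m₀ N₀ N₁ (Φ 0) =
      (injRestrict m₀ N₀ N₁ Nx)ᵀ * timeMat N₁ (Φ 0 ^ m₀) := by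
    rw [timeMat_eq, idealInterp_eq, ← blockMat_mul, stepMat_mul_interpMat hm₀ hN₀, blockMat_mul,
      injRestrict_transpose_eq, timeMat_eq]
  have hR : idealRestrict m₀ N₀ N₁ (Φ 0) *ᵥ atCPoints m₀ N₀ σ = σ := by
    rw [atCPoints, Matrix.mulVec_mulVec, injRestrict_transpose_eq, idealRestrict_eq,
      ← blockMat_mul, restrictMat_mul_injMat_transpose hm₀ hN₀, blockMat_one, Matrix.one_mulVec]
  simp only [vCycle]
  rw [residual_add, h, hR, levelOneCycle_eq Φ hN₁, Matrix.mulVec_mulVec, hA, resMat, blockMat_sub,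
    blockMat_one, blockMat_mul, Matrix.sub_mulVec, Matrix.one_mulVec, atCPoints, atCPoints,
    Matrix.mulVec_sub, ← Matrix.mulVec_mulVec, ← Matrix.mulVec_mulVec, timeMat_eq]

theorem residual_vCycle_apply (hm₀ : 1 ≤ m₀) (hN₁ : N₁ = (N₂ - 1) * m₁ + 1)
    (hN₀ : N₀ = (N₁ - 1) * m₀ + 1) (g u : Vec N₀ Nx) (p : Fin N₀ × Fin Nx)
    (hp : ¬ m₀ ∣ (p.1 : ℕ)) :
    residual (Φ 0) g (vCycle m₀ m₁ N₀ N₁ N₂ Φ g u) p = 0 := by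
  obtain ⟨σ, hσ⟩ := exists_eq_atCPoints hm₀ (by omega) hN₀ _
    (residual_fRelax_apply m₀ (Φ 0) g u)
  rw [residual_vCycle Φ hm₀ hN₁ hN₀ g u σ hσ, atCPoints_apply_of_not_dvd _ _ hp]

end Cycle

/-! ### Diagonalization -/

section Diagonalize

variable {N M Nx : ℕ}

/-- Conjugation by an invertible matrix as a ring homomorphism. -/
noncomputable def conjHom (U : Matrix (Fin Nx) (Fin Nx) ℂ) (hU : IsUnit U) :
    Matrix (Fin Nx) (Fin Nx) ℂ →+* Matrix (Fin Nx) (Fin Nx) ℂ where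
  toFun X := U * X * U⁻¹
  map_one' := by rw [mul_one, Matrix.mul_nonsing_inv _ ((Matrix.isUnit_iff_isUnit_det U).1 hU)]
  map_zero' := by simp
  map_add' X Y := by rw [mul_add, add_mul]
  map_mul' X Y := by
    have h := Matrix.nonsing_inv_mul U ((Matrix.isUnit_iff_isUnit_det U).1 hU)
    calc U * (X * Y) * U⁻¹ = U * X * 1 * Y * U⁻¹ := by rw [mul_one, mul_assoc U X Y]
      _ = _ := by rw [← h]; simp only [mul_assoc]

/-- The block diagonal operator with all diagonal blocks equal to `W`. -/
def blockDiag (N : ℕ) (W : Matrix (Fin Nx) (Fin Nx) ℂ) : Op N N Nx :=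
  (1 : Matrix (Fin N) (Fin N) ℂ) ⊗ₖ W

theorem blockDiag_mul_blockMat (W : Matrix (Fin Nx) (Fin Nx) ℂ)
    (X : Matrix (Fin N) (Fin M) (Matrix (Fin Nx) (Fin Nx) ℂ)) :
    blockDiag N W * blockMat X = blockMat (X.map fun Y => W * Y) := by
  ext ⟨i, k⟩ ⟨j, l⟩
  simp [blockDiag, blockMat_apply, Matrix.mul_apply, Fintype.sum_prod_type, Matrix.one_apply]

theorem blockMat_mul_blockDiag (W : Matrix (Fin Nx) (Fin Nx) ℂ)
    (X : Matrix (Fin N) (Fin M) (Matrix (Fin Nx) (Fin Nx) ℂ)) :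
    blockMat X * blockDiag M W = blockMat (X.map fun Y => Y * W) := by
  ext ⟨i, k⟩ ⟨j, l⟩
  simp [blockDiag, blockMat_apply, Matrix.mul_apply, Fintype.sum_prod_type, Matrix.one_apply]

/-- Intertwining relation that carries `Ũ⁻¹`, coming from the modified norm, past the propagator and
leaves the diagonalized one. -/
theorem blockDiag_inv_mul_blockMat_conj {U : Matrix (Fin Nx) (Fin Nx) ℂ} (hU : IsUnit U)
    (X : Matrix (Fin N) (Fin M) (Matrix (Fin Nx) (Fin Nx) ℂ)) :
    blockDiag N U⁻¹ * blockMat (X.map (conjHom U hU)) = blockMat X * blockDiag M U⁻¹ := by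
  rw [blockDiag_mul_blockMat, blockMat_mul_blockDiag]
  congr 1
  refine Matrix.ext fun i j => ?_
  change U⁻¹ * (U * X i j * U⁻¹) = X i j * U⁻¹
  rw [mul_assoc U, ← mul_assoc U⁻¹,
    Matrix.nonsing_inv_mul U ((Matrix.isUnit_iff_isUnit_det U).1 hU), one_mul]

theorem blockDiag_mulVec_atCPoints {m : ℕ} (W : Matrix (Fin Nx) (Fin Nx) ℂ) (σ : Vec M Nx) :
    blockDiag N W *ᵥ atCPoints m N σ = atCPoints m N (blockDiag M W *ᵥ σ) := by
  rw [atCPoints, atCPoints, Matrix.mulVec_mulVec, Matrix.mulVec_mulVec, injRestrict_transpose_eq,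
    blockDiag_mul_blockMat, blockMat_mul_blockDiag]
  congr 2
  ext i j : 2
  simp only [Matrix.map_apply, Matrix.transpose_apply, injMat, Matrix.of_apply]
  split_ifs <;> simp

theorem resMat_diagonal_apply (m : ℕ) (w y z : Fin Nx → ℂ) (i j : Fin N) :
    resMat m N M (Matrix.diagonal w) (Matrix.diagonal y) (Matrix.diagonal z) i j =
      Matrix.diagonal fun k => resMat m N M (w k) (y k) (z k) i j := by
  have h₁ := map_resMat (Matrix.diagonalRingHom (Fin Nx) ℂ) m N M w y z
  simp only [Matrix.diagonalRingHom_apply] at h₁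
  rw [← h₁, Matrix.map_apply, Matrix.diagonalRingHom_apply]
  congr 1
  ext k
  have h₂ := map_resMat (Pi.evalRingHom (fun _ : Fin Nx => ℂ) k) m N M w y z
  simp only [Pi.evalRingHom_apply] at h₂
  rw [← h₂]
  rfl

theorem errMat_diagonal_apply (m : ℕ) (w y z : Fin Nx → ℂ) (i j : Fin N) :
    errMat m N M (Matrix.diagonal w) (Matrix.diagonal y) (Matrix.diagonal z) i j =
      Matrix.diagonal fun k => errMat m N M (w k) (y k) (z k) i j := by
  have h₁ := map_errMat (Matrix.diagonalRingHom (Fin Nx) ℂ) m N M w y z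
  simp only [Matrix.diagonalRingHom_apply] at h₁
  rw [← h₁, Matrix.map_apply, Matrix.diagonalRingHom_apply]
  congr 1
  ext k
  have h₂ := map_errMat (Pi.evalRingHom (fun _ : Fin Nx => ℂ) k) m N M w y z
  simp only [Pi.evalRingHom_apply] at h₂
  rw [← h₂]
  rfl

theorem sum_norm_blockMat_diagonal_col
    {X : Matrix (Fin N) (Fin M) (Matrix (Fin Nx) (Fin Nx) ℂ)} {d : Fin N → Fin M → Fin Nx → ℂ}
    (h : ∀ i j, X i j = Matrix.diagonal (d i j)) (q : Fin M × Fin Nx) :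
    ∑ p, ‖blockMat X p q‖ = ∑ i, ‖d i q.1 q.2‖ := by
  rw [Fintype.sum_prod_type]
  refine Finset.sum_congr rfl fun i _ => ?_
  simp [blockMat_apply, h, Matrix.diagonal_apply, apply_ite norm]

theorem sum_norm_blockMat_diagonal_row
    {X : Matrix (Fin N) (Fin M) (Matrix (Fin Nx) (Fin Nx) ℂ)} {d : Fin N → Fin M → Fin Nx → ℂ}
    (h : ∀ i j, X i j = Matrix.diagonal (d i j)) (p : Fin N × Fin Nx) :
    ∑ q, ‖blockMat X p q‖ = ∑ j, ‖d p.1 j p.2‖ := by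
  rw [Fintype.sum_prod_type]
  refine Finset.sum_congr rfl fun i _ => ?_
  simp [blockMat_apply, h, Matrix.diagonal_apply, apply_ite norm]

end Diagonalize

/-! ### Norms -/

section Norms

theorem sum_norm_le_normOne {ι : Type*} [Fintype ι] (A : Matrix ι ι ℂ) (j : ι) :
    ∑ i, ‖A i j‖ ≤ normOne A :=
  le_ciSup (f := fun j => ∑ i, ‖A i j‖) (Set.finite_range _).bddAbove j

theorem sum_norm_le_normInf {ι : Type*} [Fintype ι] (A : Matrix ι ι ℂ) (i : ι) :
    ∑ j, ‖A i j‖ ≤ normInf A :=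
  le_ciSup (f := fun i => ∑ j, ‖A i j‖) (Set.finite_range _).bddAbove i

/-- The Schur test. -/
theorem l2Norm_mulVec_le {N Nx : ℕ} (A : Op N N Nx) {c r : ℝ} (hr : 0 ≤ r)
    (hcol : ∀ j, ∑ i, ‖A i j‖ ≤ c) (hrow : ∀ i, ∑ j, ‖A i j‖ ≤ r) (v : Vec N Nx) :
    l2Norm (A *ᵥ v) ≤ √(c * r) * l2Norm v := by
  have hsq : ∀ w : Vec N Nx, l2Norm w = √(∑ i, ‖w i‖ ^ 2) := fun w => EuclideanSpace.norm_eq _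
  rw [hsq, hsq, ← Real.sqrt_mul' _ (by positivity)]
  refine Real.sqrt_le_sqrt ?_
  calc ∑ i, ‖(A *ᵥ v) i‖ ^ 2 ≤ ∑ i, r * ∑ j, ‖A i j‖ * ‖v j‖ ^ 2 := by
        refine Finset.sum_le_sum fun i _ => ?_
        calc ‖(A *ᵥ v) i‖ ^ 2 ≤ (∑ j, ‖A i j‖ * ‖v j‖) ^ 2 := by
              gcongr
              simp only [← norm_mul]
              exact norm_sum_le _ _
          -- Cauchy–Schwarz with weights `‖A i j‖`.
          _ ≤ (∑ j, ‖A i j‖) * ∑ j, ‖A i j‖ * ‖v j‖ ^ 2 :=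
              Finset.sum_sq_le_sum_mul_sum_of_sq_le_mul _ (fun j _ => norm_nonneg _)
                (fun j _ => by positivity) fun j _ => le_of_eq (by ring)
          _ ≤ _ := by
              gcongr
              exact hrow i
    _ = r * ∑ j, (∑ i, ‖A i j‖) * ‖v j‖ ^ 2 := by
        rw [← Finset.mul_sum, Finset.sum_comm]
        simp only [Finset.sum_mul]
    _ ≤ r * ∑ j, c * ‖v j‖ ^ 2 := by
        gcongr with j
        exact hcol j
    _ = c * r * ∑ j, ‖v j‖ ^ 2 := by
        rw [← Finset.mul_sum]
        ring

theorem l2Norm_atCPoints {m N M Nx : ℕ} (hm : 1 ≤ m) (hN : N = (M - 1) * m + 1) (hM : 1 ≤ M)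
    (σ : Vec M Nx) : l2Norm (atCPoints m N σ) = l2Norm σ := by
  have hsq : ∀ {K : ℕ} (w : Vec K Nx), l2Norm w = √(∑ i, ‖w i‖ ^ 2) := fun w =>
    EuclideanSpace.norm_eq _
  rw [hsq, hsq]
  congr 1
  have hinj : Function.Injective fun p : Fin M × Fin Nx =>
      ((⟨p.1 * m, mul_lt_of_coarse hN p.1⟩, p.2) : Fin N × Fin Nx) := by
    rintro ⟨p, k⟩ ⟨q, l⟩ h
    simp only [Prod.mk.injEq, Fin.mk.injEq] at h
    exact Prod.ext (Fin.ext (Nat.eq_of_mul_eq_mul_right hm h.1)) h.2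
  symm
  refine Fintype.sum_of_injective _ hinj _ _ ?_ ?_
  · rintro ⟨i, k⟩ hi
    rw [atCPoints_apply_of_not_dvd]
    · simp
    · rintro ⟨q, hq⟩
      rw [mul_comm] at hq
      have hqM : q < M := coarse_lt hm hM (a := 0) (by have := i.2; simp only at hq; omega)
      exact hi ⟨(⟨q, hqM⟩, k), by simpa [Prod.ext_iff, Fin.ext_iff] using hq.symm⟩
  · rintro ⟨p, k⟩
    rw [atCPoints_apply_mul hm σ _ p rfl]

theorem modNorm_eq {N Nx : ℕ} {U : Matrix (Fin Nx) (Fin Nx) ℂ} (r : Vec N Nx) :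
    modNorm U r = l2Norm (blockDiag N U⁻¹ *ᵥ r) := by
  have hinv : (blockDiag N U * (blockDiag N U)ᴴ)⁻¹ = (blockDiag N U⁻¹)ᴴ * blockDiag N U⁻¹ := by
    rw [Matrix.mul_inv_rev, ← Matrix.conjTranspose_nonsing_inv]
    simp only [blockDiag, Matrix.inv_kronecker, inv_one]
  have h : modNorm U r = √(star r ⬝ᵥ ((blockDiag N U * (blockDiag N U)ᴴ)⁻¹ *ᵥ r)).re := rfl
  rw [h, hinv, ← Matrix.mulVec_mulVec, Matrix.dotProduct_mulVec, ← Matrix.star_mulVec, l2Norm,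
    EuclideanSpace.norm_eq]
  congr 1
  simp only [dotProduct, Complex.re_sum]
  refine Finset.sum_congr rfl fun i _ => ?_
  rw [Pi.star_apply, ← Complex.normSq_eq_norm_sq, Complex.normSq_apply]
  simp [Complex.mul_re]

theorem modNorm_unitary {N Nx : ℕ} {U : Matrix (Fin Nx) (Fin Nx) ℂ}
    (hU : U ∈ Matrix.unitaryGroup (Fin Nx) ℂ) : modNorm (N := N) U = l2Norm := by
  have hV : blockDiag N U * (blockDiag N U)ᴴ = 1 := by
    rw [blockDiag, Matrix.conjTranspose_kronecker, ← Matrix.mul_kronecker_mul,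
      ← Matrix.star_eq_conjTranspose U, Matrix.mem_unitaryGroup_iff.1 hU]
    simp
  ext r
  have h : modNorm U r = √(star r ⬝ᵥ ((blockDiag N U * (blockDiag N U)ᴴ)⁻¹ *ᵥ r)).re := rfl
  rw [h, hV, inv_one, Matrix.one_mulVec, l2Norm, EuclideanSpace.norm_eq]
  congr 1
  simp only [dotProduct, Complex.re_sum]
  refine Finset.sum_congr rfl fun i _ => ?_
  rw [Pi.star_apply, ← Complex.normSq_eq_norm_sq, Complex.normSq_apply]
  simp [Complex.mul_re]

end Norms

/-! ### Convergence -/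

section Convergence

variable {Nx m₀ m₁ N₀ N₁ N₂ : ℕ}

theorem errPropCoarse_diagonal_eq (hm₀ : 1 ≤ m₀) (hN₀ : N₀ = (N₁ - 1) * m₀ + 1)
    (lam : Fin 3 → Fin Nx → ℂ) :
    errPropCoarse m₀ m₁ N₀ N₁ N₂ (fun l => Matrix.diagonal (lam l)) =
      blockMat (errMat m₁ N₁ N₂ (Matrix.diagonal (lam 0 ^ m₀)) (Matrix.diagonal (lam 1))
        (Matrix.diagonal (lam 2))) := by
  rw [errPropCoarse_eq _ hm₀ hN₀, Matrix.diagonal_pow]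

theorem normOne_errPropCoarse (hNx : 1 ≤ Nx) (hm₀ : 1 ≤ m₀) (hm₁ : 1 ≤ m₁) (hN₂ : 2 ≤ N₂)
    (hN₁ : N₁ = (N₂ - 1) * m₁ + 1) (hN₀ : N₀ = (N₁ - 1) * m₀ + 1) (lam : Fin 3 → Fin Nx → ℂ)
    (hlam : ∀ l k, ‖lam l k‖ < 1) :
    normOne (errPropCoarse m₀ m₁ N₀ N₁ N₂ fun l => Matrix.diagonal (lam l)) =
      ⨆ k : Fin Nx, ⨆ j : Fin m₁, colSum m₀ m₁ N₂ (lam 0 k) (lam 1 k) (lam 2 k) j := by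
  have : Nonempty (Fin Nx) := ⟨⟨0, hNx⟩⟩
  have : Nonempty (Fin m₁) := ⟨⟨0, hm₁⟩⟩
  have : Nonempty (Fin N₁) := ⟨⟨0, by omega⟩⟩
  have hcol : ∀ q : Fin N₁ × Fin Nx, _ := sum_norm_blockMat_diagonal_col
    (errMat_diagonal_apply (N := N₁) (M := N₂) m₁ (lam 0 ^ m₀) (lam 1) (lam 2))
  rw [errPropCoarse_diagonal_eq hm₀ hN₀]
  refine le_antisymm (ciSup_le fun ⟨j, k⟩ => ?_) (ciSup_le fun k => ciSup_le fun c => ?_)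
  · obtain ⟨b, hb⟩ := exists_col_le (m₀ := m₀) (x := lam 0 k) (hlam 1 k) (hlam 2 k) hm₁ hN₂ hN₁ j
    rw [hcol]
    refine hb.trans ((le_ciSup (f := fun b : Fin m₁ => colSum m₀ m₁ N₂ (lam 0 k) (lam 1 k)
      (lam 2 k) b) (Set.finite_range _).bddAbove b).trans ?_)
    exact le_ciSup (f := fun k => ⨆ b : Fin m₁, colSum m₀ m₁ N₂ (lam 0 k) (lam 1 k)
      (lam 2 k) b) (Set.finite_range _).bddAbove k
  · obtain ⟨j, hj⟩ := exists_col_eq (m₀ := m₀) (x := lam 0 k) (hlam 1 k) (hlam 2 k) hm₁ hN₂ hN₁ c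
    rw [← hj]
    exact (hcol (j, k)).symm.le.trans (sum_norm_le_normOne _ (j, k))

theorem normInf_errPropCoarse (hNx : 1 ≤ Nx) (hm₀ : 1 ≤ m₀) (hm₁ : 1 ≤ m₁) (hN₂ : 2 ≤ N₂)
    (hN₁ : N₁ = (N₂ - 1) * m₁ + 1) (hN₀ : N₀ = (N₁ - 1) * m₀ + 1) (lam : Fin 3 → Fin Nx → ℂ)
    (hlam : ∀ l k, ‖lam l k‖ < 1) :
    normInf (errPropCoarse m₀ m₁ N₀ N₁ N₂ fun l => Matrix.diagonal (lam l)) =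
      ⨆ k : Fin Nx, ⨆ j : Fin m₁, rowSum m₀ m₁ N₂ (lam 0 k) (lam 1 k) (lam 2 k) j := by
  have : Nonempty (Fin Nx) := ⟨⟨0, hNx⟩⟩
  have : Nonempty (Fin m₁) := ⟨⟨0, hm₁⟩⟩
  have : Nonempty (Fin N₁) := ⟨⟨0, by omega⟩⟩
  have hrow : ∀ p : Fin N₁ × Fin Nx, _ := sum_norm_blockMat_diagonal_row
    (errMat_diagonal_apply (N := N₁) (M := N₂) m₁ (lam 0 ^ m₀) (lam 1) (lam 2))
  rw [errPropCoarse_diagonal_eq hm₀ hN₀]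
  refine le_antisymm (ciSup_le fun ⟨i, k⟩ => ?_) (ciSup_le fun k => ciSup_le fun c => ?_)
  · obtain ⟨b, hb⟩ := exists_row_le (m₀ := m₀) (x := lam 0 k) (hlam 1 k) (hlam 2 k) hm₁ hN₂ hN₁ i
    rw [hrow]
    refine hb.trans ((le_ciSup (f := fun b : Fin m₁ => rowSum m₀ m₁ N₂ (lam 0 k) (lam 1 k)
      (lam 2 k) b) (Set.finite_range _).bddAbove b).trans ?_)
    exact le_ciSup (f := fun k => ⨆ b : Fin m₁, rowSum m₀ m₁ N₂ (lam 0 k) (lam 1 k)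
      (lam 2 k) b) (Set.finite_range _).bddAbove k
  · obtain ⟨i, hi⟩ := exists_row_eq (m₀ := m₀) (x := lam 0 k) (hlam 1 k) (hlam 2 k) hm₁ hN₂ hN₁ c
    rw [← hi]
    exact (hrow (i, k)).symm.le.trans (sum_norm_le_normInf _ (i, k))

theorem l2Norm_resMat_mulVec_le (hm₁ : 1 ≤ m₁) (hN₁ : N₁ = (N₂ - 1) * m₁ + 1)
    (w y z : Fin Nx → ℂ) (v : Vec N₁ Nx) :
    let E := blockMat (errMat m₁ N₁ N₂ (Matrix.diagonal w) (Matrix.diagonal y) (Matrix.diagonal z))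
    l2Norm (blockMat (resMat m₁ N₁ N₂ (Matrix.diagonal w) (Matrix.diagonal y)
      (Matrix.diagonal z)) *ᵥ v) ≤ √(normOne E * normInf E) * l2Norm v := by
  intro E
  -- Time reversal exchanges the roles: column sums of the residual propagator are row sums of `E`,
  -- and conversely.
  rw [mul_comm (normOne E)]
  refine l2Norm_mulVec_le _ ?_ (fun q => ?_) (fun p => ?_) v
  · exact Real.iSup_nonneg fun j => by positivity
  · rw [sum_norm_blockMat_diagonal_col (resMat_diagonal_apply m₁ w y z)]
    refine le_trans (le_of_eq ?_) (sum_norm_le_normInf E (q.1.rev, q.2))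
    rw [sum_norm_blockMat_diagonal_row (errMat_diagonal_apply m₁ w y z),
      ← Equiv.sum_comp Fin.revPerm]
    simp only [resMat_eq_errMat_rev hm₁ hN₁, Fin.revPerm_apply, Fin.rev_rev]
  · rw [sum_norm_blockMat_diagonal_row (resMat_diagonal_apply m₁ w y z)]
    refine le_trans (le_of_eq ?_) (sum_norm_le_normOne E (p.1.rev, p.2))
    rw [sum_norm_blockMat_diagonal_col (errMat_diagonal_apply m₁ w y z),
      ← Equiv.sum_comp Fin.revPerm]
    simp only [resMat_eq_errMat_rev hm₁ hN₁, Fin.revPerm_apply, Fin.rev_rev]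

theorem modNorm_residual_vCycle_le (hm₀ : 1 ≤ m₀) (hm₁ : 1 ≤ m₁)
    (hN₁ : N₁ = (N₂ - 1) * m₁ + 1) (hN₀ : N₀ = (N₁ - 1) * m₀ + 1)
    {Φ : Fin 3 → Matrix (Fin Nx) (Fin Nx) ℂ} {U : Matrix (Fin Nx) (Fin Nx) ℂ}
    {lam : Fin 3 → Fin Nx → ℂ} (hU : IsUnit U)
    (hΦ : ∀ l, Φ l = U * Matrix.diagonal (lam l) * U⁻¹) (g u : Vec N₀ Nx)
    (h : ∀ p : Fin N₀ × Fin Nx, ¬ m₀ ∣ (p.1 : ℕ) → residual (Φ 0) g u p = 0) :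
    let E := errPropCoarse m₀ m₁ N₀ N₁ N₂ (fun l => Matrix.diagonal (lam l))
    modNorm U (residual (Φ 0) g (vCycle m₀ m₁ N₀ N₁ N₂ Φ g u)) ≤
      √(normOne E * normInf E) * modNorm U (residual (Φ 0) g u) := by
  intro E
  have hN₁' : 1 ≤ N₁ := by omega
  obtain ⟨σ, hσ⟩ := exists_eq_atCPoints hm₀ hN₁' hN₀ _ h
  have hconj : resMat m₁ N₁ N₂ (Φ 0 ^ m₀) (Φ 1) (Φ 2) =
      (resMat m₁ N₁ N₂ (Matrix.diagonal (lam 0 ^ m₀)) (Matrix.diagonal (lam 1))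
        (Matrix.diagonal (lam 2))).map (conjHom U hU) := by
    have hl : ∀ l, Φ l = conjHom U hU (Matrix.diagonal (lam l)) := hΦ
    rw [map_resMat, ← Matrix.diagonal_pow, map_pow, ← hl, ← hl, ← hl]
  rw [residual_vCycle Φ hm₀ hN₁ hN₀ g u σ (by rw [fRelax_eq_self _ _ _ _ h, hσ]), hσ, modNorm_eq,
    modNorm_eq, blockDiag_mulVec_atCPoints, blockDiag_mulVec_atCPoints,
    l2Norm_atCPoints hm₀ hN₀ hN₁', l2Norm_atCPoints hm₀ hN₀ hN₁', hconj, Matrix.mulVec_mulVec,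
    blockDiag_inv_mul_blockMat_conj, ← Matrix.mulVec_mulVec]
  have hE : E = _ := errPropCoarse_diagonal_eq hm₀ hN₀ lam
  rw [hE]
  exact l2Norm_resMat_mulVec_le hm₁ hN₁ _ _ _ _

theorem convFactor_modNorm_le (hm₀ : 1 ≤ m₀) (hm₁ : 1 ≤ m₁)
    (hN₁ : N₁ = (N₂ - 1) * m₁ + 1) (hN₀ : N₀ = (N₁ - 1) * m₀ + 1)
    {Φ : Fin 3 → Matrix (Fin Nx) (Fin Nx) ℂ} {U : Matrix (Fin Nx) (Fin Nx) ℂ}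
    {lam : Fin 3 → Fin Nx → ℂ} (hU : IsUnit U)
    (hΦ : ∀ l, Φ l = U * Matrix.diagonal (lam l) * U⁻¹) (g u : Vec N₀ Nx)
    (h : ∀ p : Fin N₀ × Fin Nx, ¬ m₀ ∣ (p.1 : ℕ) → residual (Φ 0) g u p = 0) :
    let E := errPropCoarse m₀ m₁ N₀ N₁ N₂ (fun l => Matrix.diagonal (lam l))
    convFactor m₀ m₁ N₀ N₁ N₂ Φ (modNorm U) g u ≤ ENNReal.ofReal √(normOne E * normInf E) := by
  intro E
  -- The multiplicative form also covers a vanishing denominator, where it forces the numerator to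
  -- vanish.
  refine iSup_le fun i => ENNReal.div_le_of_le_mul ?_
  rw [← ENNReal.ofReal_mul (Real.sqrt_nonneg _)]
  refine ENNReal.ofReal_le_ofReal ?_
  rw [Function.iterate_succ_apply']
  refine modNorm_residual_vCycle_le hm₀ hm₁ hN₁ hN₀ hU hΦ g _ ?_
  -- Only the initial residual needs the hypothesis; every later iterate comes out of a V-cycle and
  -- has zero residual at the F-points.
  cases i with
  | zero => exact h
  | succ i =>
    rw [Function.iterate_succ_apply']
    exact residual_vCycle_apply Φ hm₀ hN₁ hN₀ g _

end Convergence

end MGRIT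

theorem mainTheorem4 (Nx m₀ m₁ N₀ N₁ N₂ : ℕ) (hNx : 1 ≤ Nx) (hm₀ : 1 ≤ m₀) (hm₁ : 1 ≤ m₁)
    (hN₂ : 2 ≤ N₂) (hN₁ : N₁ = (N₂ - 1) * m₁ + 1) (hN₀ : N₀ = (N₁ - 1) * m₀ + 1)
    (Φ : Fin 3 → Matrix (Fin Nx) (Fin Nx) ℂ)
    (U : Matrix (Fin Nx) (Fin Nx) ℂ) (lam : Fin 3 → Fin Nx → ℂ)
    (hU : IsUnit U) (hΦ : ∀ l, Φ l = U * Matrix.diagonal (lam l) * U⁻¹)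
    (hlam : ∀ l k, ‖lam l k‖ < 1) :
    let E : MGRIT.Op N₁ N₁ Nx :=
      MGRIT.errPropCoarse m₀ m₁ N₀ N₁ N₂ (fun l => Matrix.diagonal (lam l))
    (∀ g u : MGRIT.Vec N₀ Nx,
      ((∀ p : Fin N₀ × Fin Nx, ¬ m₀ ∣ (p.1 : ℕ) → MGRIT.residual (Φ 0) g u p = 0) ∨
        (∃ v, u = MGRIT.vCycle m₀ m₁ N₀ N₁ N₂ Φ g v)) →
      MGRIT.convFactor m₀ m₁ N₀ N₁ N₂ Φ (MGRIT.modNorm U) g u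
          ≤ ENNReal.ofReal √(MGRIT.normOne E * MGRIT.normInf E) ∧
        (U ∈ Matrix.unitaryGroup (Fin Nx) ℂ →
          MGRIT.convFactor m₀ m₁ N₀ N₁ N₂ Φ MGRIT.l2Norm g u
            ≤ ENNReal.ofReal √(MGRIT.normOne E * MGRIT.normInf E))) ∧
    MGRIT.normOne E =
      (⨆ k : Fin Nx, ⨆ j : Fin m₁, MGRIT.colSum m₀ m₁ N₂ (lam 0 k) (lam 1 k) (lam 2 k) j) ∧
    MGRIT.normInf E =
      (⨆ k : Fin Nx, ⨆ j : Fin m₁, MGRIT.rowSum m₀ m₁ N₂ (lam 0 k) (lam 1 k) (lam 2 k) j) := by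
  intro E
  refine ⟨fun g u hu => ?_, MGRIT.normOne_errPropCoarse hNx hm₀ hm₁ hN₂ hN₁ hN₀ lam hlam,
    MGRIT.normInf_errPropCoarse hNx hm₀ hm₁ hN₂ hN₁ hN₀ lam hlam⟩
  have h : ∀ p : Fin N₀ × Fin Nx, ¬ m₀ ∣ (p.1 : ℕ) → MGRIT.residual (Φ 0) g u p = 0 := by
    rcases hu with hu | ⟨v, rfl⟩
    · exact hu
    · exact MGRIT.residual_vCycle_apply Φ hm₀ hN₁ hN₀ g v
  have hle := MGRIT.convFactor_modNorm_le (N₂ := N₂) hm₀ hm₁ hN₁ hN₀ hU hΦ g u h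
  exact ⟨hle, fun hunit => MGRIT.modNorm_unitary (N := N₀) hunit ▸ hle⟩
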